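/- Let $N\ge 1$, let $m_1>m_2>\dots>m_N>0$ be masses and let $c>0$. Consider $N$ balls (point particles) on the half line with positions $0\le q_1\le\dots\le q_N$, momenta $p_i$, velocities $v_i=p_i/m_i$ and total energy $H(q,p)=\sum_{i=1}^N\left(\frac{p_i^2}{2m_i}+m_iq_i\right)=c$. Between collisions $\dot q_i=p_i/m_i$, $\dot p_i=-m_i$, except that a ball at rest on the floor ($q_j=p_j=0$ for all $j\le i$) stays at rest until it is hit. A floor collision $(0,1)$ takes place when $q_1=0$, $v_1^-<0$, and gives $p_1^+=-p_1^-$. An $(i,i+1)$ collision takes place when $q_i=q_{i+1}$, $v_i^->v_{i+1}^-$, and is elastic: with $\gamma_i=\frac{m_i-m_{i+1}}{m_i+m_{i+1}}$, $p_i^+=\gamma_ip_i^-+(1+\gamma_i)p_{i+1}^-$ and $p_{i+1}^+=(1-\gamma_i)p_i^--\gamma_ip_{i+1}^-$. Here $^-$ and $^+$ denote the values right before and right after the collision. When several collisions are due at the same time they are performed one after another, in any order (further collisions caused at that instant included); different orders give different branches of the orbit. Let $\mathcal M$ be the set of states $(q,p)$ as above right after a collision, i.e. with $q_1=0$, $v_1\ge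 0$, or with $q_i=q_{i+1}$, $v_i\le v_{i+1}$ for some $i\in\{1,\dots,N-1\}$. There is a constant $C>0$ (depending only on $N$, $m_1,\dots,m_N$ and $c$) such that every $x\in\mathcal M$ has at least one forward orbit with infinitely many successive collisions and, for every such orbit (every branch) starting at $x$ and every $i\in\{1,\dots,N-1\}$, there is a sequence of pairwise distinct $(i,i+1)$ collisions along the orbit whose collision times $\mathtt t_1\le\mathtt t_2\le\dots$ tend to $+\infty$ and which satisfy $$v_i^-(\mathtt t_n)-v_{i+1}^-(\mathtt t_n)\ \ge\ C\qquad\text{for all } n .$$ -/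

import Mathlib

noncomputable section

namespace FallingBalls

/-- A point `(q, p)` of the phase space of `N = n + 1` balls on the half line: positions and momenta,
indexed from the bottom ball `0` to the top ball `n`. -/
@[ext]
structure Phase (n : ℕ) where
  q : Fin (n + 1) → ℝ
  p : Fin (n + 1) → ℝ

/-- The possible collisions: the bottom ball with the floor, or, for `i : Fin n`, the ball
`i.castSucc` with the ball `i.succ` immediately above it. -/
inductive Collision (n : ℕ) where
  | floor : Collision n
  | pair (i : Fin n) : Collision n

variable {n : ℕ}

/-- The velocity `v_i = p_i / m_i`. -/
def vel (m : Fin (n + 1) → ℝ) (x : Phase n) (i : Fin (n + 1)) : ℝ := x.p i / m i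

/-- The Hamiltonian `H(q, p) = ∑ p_i ^ 2 / (2 m_i) + m_i q_i`. -/
def energy (m : Fin (n + 1) → ℝ) (x : Phase n) : ℝ :=
  ∑ i, (x.p i ^ 2 / (2 * m i) + m i * x.q i)

/-- The states of energy `c` with `0 ≤ q_0 ≤ q_1 ≤ … ≤ q_n`. -/
def energySurface (m : Fin (n + 1) → ℝ) (c : ℝ) : Set (Phase n) :=
  {x | 0 ≤ x.q 0 ∧ Monotone x.q ∧ energy m x = c}

/-- The states right after the given collision. -/
def postCollision (m : Fin (n + 1) → ℝ) (c : ℝ) : Collision n → Set (Phase n)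
  | .floor => {x | x ∈ energySurface m c ∧ x.q 0 = 0 ∧ 0 ≤ vel m x 0}
  | .pair i => {x | x ∈ energySurface m c ∧ x.q i.castSucc = x.q i.succ ∧
      vel m x i.castSucc ≤ vel m x i.succ}

/-- The states right before the given collision. -/
def preCollision (m : Fin (n + 1) → ℝ) (c : ℝ) : Collision n → Set (Phase n)
  | .floor => {x | x ∈ energySurface m c ∧ x.q 0 = 0 ∧ vel m x 0 < 0}
  | .pair i => {x | x ∈ energySurface m c ∧ x.q i.castSucc = x.q i.succ ∧
      vel m x i.succ < vel m x i.castSucc}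

/-- The Poincaré section `ℳ`: the states right after some collision. -/
def poincareSection (m : Fin (n + 1) → ℝ) (c : ℝ) : Set (Phase n) := ⋃ κ, postCollision m c κ

/-- The set `ℳᵇ` of the states right before some collision. -/
def preSection (m : Fin (n + 1) → ℝ) (c : ℝ) : Set (Phase n) := ⋃ κ, preCollision m c κ

/-- `γ_i = (m_i - m_{i+1}) / (m_i + m_{i+1})`. -/
def gamma (m : Fin (n + 1) → ℝ) (i : Fin n) : ℝ :=
  (m i.castSucc - m i.succ) / (m i.castSucc + m i.succ)

/-- The elastic collision map `(q, p⁻) ↦ (q, p⁺)`. -/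
def collide (m : Fin (n + 1) → ℝ) : Collision n → Phase n → Phase n
  | .floor, x => ⟨x.q, Function.update x.p 0 (-x.p 0)⟩
  | .pair i, x => ⟨x.q, fun j =>
      if j = i.castSucc then gamma m i * x.p i.castSucc + (1 + gamma m i) * x.p i.succ
      else if j = i.succ then (1 - gamma m i) * x.p i.castSucc - gamma m i * x.p i.succ
      else x.p j⟩

/-- Ball `j` rests on the floor: it and all the balls below it are at height `0` with momentum `0`. -/
def Resting (x : Phase n) (j : Fin (n + 1)) : Prop := ∀ k ≤ j, x.q k = 0 ∧ x.p k = 0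

open Classical in
/-- The flow between collisions: the solution of `q_j' = p_j / m_j`, `p_j' = - m_j` at time `t`.
In the degenerate case of a ball at rest on the floor, where this solution would at once leave
`0 ≤ q_0`, the ball stays at rest (until it is hit from above). -/
def flow (m : Fin (n + 1) → ℝ) (t : ℝ) (x : Phase n) : Phase n where
  q j := if Resting x j then 0 else x.q j + t * vel m x j - t ^ 2 / 2
  p j := if Resting x j then 0 else x.p j - t * m j

/-- `τ` is the first time at which the flow line of `x` is in `ℳᵇ`. It is `0` if `x` is already in
`ℳᵇ`, as happens within a multiple collision. -/
def IsReturnTime (m : Fin (n + 1) → ℝ) (c : ℝ) (x : Phase n) (τ : ℝ) : Prop :=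
  IsLeast {t | 0 ≤ t ∧ flow m t x ∈ preSection m c} τ

/-- A forward orbit (one branch of it, if there are singular collisions) starting at `x` at time `0`:
`state k` is the state after `k` collisions, the last of which took place at `time k`, and `coll k`
is the collision leading from `state k` to `state (k + 1)`. If several collisions are due at the
same time, any one of them may be performed first; each choice gives its own branch. -/
structure Orbit (m : Fin (n + 1) → ℝ) (c : ℝ) (x : Phase n) where
  state : ℕ → Phase n
  time : ℕ → ℝ
  coll : ℕ → Collision n
  state_zero : state 0 = x
  time_zero : time 0 = 0
  isReturnTime : ∀ k, IsReturnTime m c (state k) (time (k + 1) - time k)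
  mem_preCollision : ∀ k,
    flow m (time (k + 1) - time k) (state k) ∈ preCollision m c (coll k)
  state_succ : ∀ k,
    state (k + 1) = collide m (coll k) (flow m (time (k + 1) - time k) (state k))

/-- The state right before the collision `coll k`, which takes place at `time (k + 1)`. -/
def Orbit.pre {m : Fin (n + 1) → ℝ} {c : ℝ} {x : Phase n} (o : Orbit m c x) (k : ℕ) : Phase n :=
  flow m (o.time (k + 1) - o.time k) (o.state k)

end FallingBalls

end

namespace FallingBalls

open Finset

/-! The engine is a uniform collision count, `exists_hits_le`: in bounded time, while the balls `0,
…, w` keep energy at least `E`, collision `w` occurs at most `N` times, with `N` independent of the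
orbit. The proof is an induction on the window `[l, r]` of collisions that may occur. If some
collision of the window is missing, the window shrinks and the induction hypothesis applies. Hence a
stretch with many collisions `w` contains every collision of the window, and such a stretch is
expensive. If the window contains the floor, small impulses and little elapsed time would force all
its balls to be almost at rest on the floor, against the energy bound. If it does not, the balls
fall freely together, and small impulses would force their velocities to be almost equal, against
the conservation of their relative kinetic energy. A weighted momentum that every collision raises
limits the total impulse, so only boundedly many expensive stretches fit.

The count first gives `tendsto_t`: working down from the top ball, an accumulation of collision
times would leave no collision that can still occur. It then turns total impulse into a single
strong impulse. Gravity takes a definite momentum from the top ball, boundedly many collisions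
restore it, so one of them is strong (`exists_strong_top`). Strength passes downward
(`exists_strong_step`): a strong hit on ball `w` from above means that this ball was rising fast
before it or is falling fast after it. Were all nearby collisions `w` weak, its velocity could
change only little, so its path, followed into the past or the future, would cross the floor.

Orbits exist because flow lines can be continued until some gap closes with negative slope
(`exists_isReturnTime`), and this can be iterated. -/

/-- The data of a forward orbit that the estimates use. Balls and collisions are numbered by `ℕ`: the
collision `0` is with the floor, the collision `i + 1` is between the balls `i` and `i + 1`.
`q k`, `v k` are positions and velocities after `k` collisions, `u k` are the velocities right before
the next collision `W k`, which transfers the momentum `J k`. -/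
structure BallSeq (n : ℕ) (m : ℕ → ℝ) (c : ℝ) where
  t : ℕ → ℝ
  q : ℕ → ℕ → ℝ
  v : ℕ → ℕ → ℝ
  u : ℕ → ℕ → ℝ
  W : ℕ → ℕ
  J : ℕ → ℝ
  W_le : ∀ k, W k ≤ n
  J_pos : ∀ k, 0 < J k
  t_le : ∀ k, t k ≤ t (k + 1)
  q_nonneg : ∀ k, ∀ j ≤ n, 0 ≤ q k j
  energy_eq : ∀ k, ∑ j ∈ Icc 0 n, m j * (v k j ^ 2 / 2 + q k j) = c
  fall : ∀ k, ∀ j ≤ n, u k j = v k j - (t (k + 1) - t k) ∨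
    ((∀ i ≤ j, q k i = 0 ∧ v k i = 0) ∧ u k j = 0)
  move : ∀ k, ∀ j ≤ n, q (k + 1) j = q k j + (t (k + 1) - t k) * ((v k j + u k j) / 2)
  hit : ∀ k, ∀ j ≤ n, m j * v (k + 1) j =
    m j * u k j + (if W k = j then J k else 0) - (if W k = j + 1 then J k else 0)
  floor : ∀ k, W k = 0 → J k = -(2 * m 0 * u k 0) ∧ q (k + 1) 0 = 0
  pair : ∀ k i, W k = i + 1 →
    J k * (m i + m (i + 1)) = 2 * m i * m (i + 1) * (u k i - u k (i + 1)) ∧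
      q (k + 1) i = q (k + 1) (i + 1)
  frozen : ∀ k, ∀ j ≤ n, q k j = 0 → v k j < 0 → t (k + 1) = t k

/-! ### Conservation laws and a priori bounds -/

namespace BallSeq

variable {n : ℕ} {m : ℕ → ℝ} {c : ℝ} (S : BallSeq n m c)

/-- The energy of the balls `0, …, r`. -/
noncomputable def clusterEnergy (k r : ℕ) : ℝ := ∑ j ∈ Icc 0 r, m j * (S.v k j ^ 2 / 2 + S.q k j)

/-- The number of collisions `w` among the collisions with index in `[a, b)`. -/
def hits (w a b : ℕ) : ℕ := #{k ∈ Ico a b | S.W k = w}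

theorem t_mono : Monotone S.t := monotone_nat_of_le_succ S.t_le

/-- Summation by parts for the momentum jumps. The weight `f` is chosen later: `1` for momentum, `v
+ u` for kinetic energy, the ball number for the momenta that every collision raises. -/
theorem sum_mul_jump (f : ℕ → ℝ) {α β k : ℕ} (hβ : β ≤ n) (hαβ : α ≤ β) (h : S.W k ≠ β + 1) :
    ∑ j ∈ Icc α β, f j * (m j * S.v (k + 1) j - m j * S.u k j) =
      if S.W k = α then S.J k * f α
      else if α < S.W k ∧ S.W k ≤ β then S.J k * (f (S.W k) - f (S.W k - 1)) else 0 := by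
  have h1 : ∑ j ∈ Icc α β, f j * (m j * S.v (k + 1) j - m j * S.u k j) =
      ∑ j ∈ Icc α β, (if S.W k = j then f j * S.J k else 0) -
        ∑ j ∈ Icc α β, (if S.W k = j + 1 then f j * S.J k else 0) := by
    rw [← sum_sub_distrib]
    refine sum_congr rfl fun j hj => ?_
    rw [S.hit k j ((mem_Icc.1 hj).2.trans hβ)]
    split_ifs <;> ring
  rw [h1, sum_ite_eq]
  obtain hW | ⟨i, hW⟩ : S.W k = 0 ∨ ∃ i, S.W k = i + 1 := by
    cases S.W k <;> simp
  · rw [sum_eq_zero (s := Icc α β) (f := fun j => if S.W k = j + 1 then f j * S.J k else 0)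
      (fun j _ => if_neg (by omega))]
    simp only [hW, mem_Icc]
    split_ifs <;> first | omega | (try subst_vars; ring)
  · have h2 : ∀ j, (if S.W k = j + 1 then f j * S.J k else 0) =
        if i = j then f j * S.J k else 0 := fun j => if_congr (by omega) rfl rfl
    simp only [h2, sum_ite_eq]
    simp only [hW, mem_Icc, Nat.add_sub_cancel]
    split_ifs <;> first | omega | (try subst_vars; ring)

section masses
variable (hm : ∀ j, 0 < m j)
include hm

theorem v_floor {k : ℕ} (h : S.W k = 0) : S.v (k + 1) 0 = -S.u k 0 := by
  have h1 := S.hit k 0 (Nat.zero_le _)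
  rw [h, if_pos rfl, if_neg (by omega), (S.floor k h).1] at h1
  have := hm 0
  apply mul_left_cancel₀ this.ne'
  linarith

theorem v_pair {k i : ℕ} (h : S.W k = i + 1) :
    S.v (k + 1) (i + 1) - S.v (k + 1) i = S.u k i - S.u k (i + 1) := by
  have hn := S.W_le k
  have h1 := S.hit k i (by omega)
  have h2 := S.hit k (i + 1) (by omega)
  rw [h, if_neg (by omega), if_pos rfl] at h1
  rw [h, if_pos rfl, if_neg (by omega)] at h2
  have h3 := (S.pair k i h).1
  have a := hm i
  have b := hm (i + 1)
  apply mul_left_cancel₀ (mul_pos a b).ne'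
  linear_combination m i * h2 - m (i + 1) * h1 + h3

/-- Elastic collisions reverse the relative velocity, so the weight `v + u` agrees on the two balls
that collide. A collision at the lower end is harmless only if it is with the floor, where `v + u =
0`. -/
theorem sum_sq_jump {α β k : ℕ} (hβ : β ≤ n) (hαβ : α ≤ β) (h : S.W k ≠ β + 1)
    (hα : S.W k = α → α = 0) :
    ∑ j ∈ Icc α β, m j * S.v (k + 1) j ^ 2 = ∑ j ∈ Icc α β, m j * S.u k j ^ 2 := by
  rw [← sub_eq_zero, ← sum_sub_distrib]
  have h1 := S.sum_mul_jump (fun j => S.v (k + 1) j + S.u k j) hβ hαβ h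
  rw [sum_congr rfl fun j _ => show m j * S.v (k + 1) j ^ 2 - m j * S.u k j ^ 2 =
    (S.v (k + 1) j + S.u k j) * (m j * S.v (k + 1) j - m j * S.u k j) by ring, h1]
  split_ifs with h2 h3
  · have := hα h2
    subst this
    rw [S.v_floor hm h2]; ring
  · obtain ⟨i, hi⟩ : ∃ i, S.W k = i + 1 := ⟨S.W k - 1, by omega⟩
    have := S.v_pair hm hi
    simp only [hi, Nat.add_sub_cancel]
    linear_combination S.J k * this
  · rfl

omit hm in
theorem fall_energy {k j : ℕ} (hj : j ≤ n) :
    S.u k j ^ 2 / 2 + S.q (k + 1) j = S.v k j ^ 2 / 2 + S.q k j := by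
  rw [S.move k j hj]
  rcases S.fall k j hj with h | ⟨h, h'⟩
  · rw [h]; ring
  · rw [h', (h j le_rfl).1, (h j le_rfl).2]; ring

theorem clusterEnergy_succ {k r : ℕ} (hr : r ≤ n) (h : S.W k ≠ r + 1) :
    S.clusterEnergy (k + 1) r = S.clusterEnergy k r := by
  have h1 := S.sum_sq_jump hm hr (Nat.zero_le r) h (fun _ => rfl)
  have h2 : S.clusterEnergy k r = ∑ j ∈ Icc 0 r, m j * (S.u k j ^ 2 / 2 + S.q (k + 1) j) :=
    sum_congr rfl fun j hj => by rw [S.fall_energy ((mem_Icc.1 hj).2.trans hr)]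
  have h3 : ∀ x : ℕ → ℝ, ∑ j ∈ Icc 0 r, m j * (x j ^ 2 / 2 + S.q (k + 1) j) =
      (∑ j ∈ Icc 0 r, m j * x j ^ 2) / 2 + ∑ j ∈ Icc 0 r, m j * S.q (k + 1) j := by
    intro x
    rw [sum_div, ← sum_add_distrib]
    exact sum_congr rfl fun j _ => by ring
  rw [h2, clusterEnergy, h3, h3, h1]

theorem clusterEnergy_mono {k r s : ℕ} (hrs : r ≤ s) (hs : s ≤ n) :
    S.clusterEnergy k r ≤ S.clusterEnergy k s := by
  refine sum_le_sum_of_subset_of_nonneg (Icc_subset_Icc_right hrs) fun j hj _ => ?_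
  have := S.q_nonneg k j ((mem_Icc.1 hj).2.trans hs)
  have := hm j
  positivity

theorem ball_le_clusterEnergy {k r : ℕ} (hr : r ≤ n) :
    m r * (S.v k r ^ 2 / 2 + S.q k r) ≤ S.clusterEnergy k r := by
  refine single_le_sum (f := fun j => m j * (S.v k j ^ 2 / 2 + S.q k j)) (fun j hj => ?_)
    (mem_Icc.2 ⟨Nat.zero_le r, le_rfl⟩)
  have := S.q_nonneg k j ((mem_Icc.1 hj).2.trans hr)
  have := hm j
  positivity

theorem ball_le_energy {k j : ℕ} (hj : j ≤ n) : m j * (S.v k j ^ 2 / 2 + S.q k j) ≤ c :=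
  (S.ball_le_clusterEnergy hm hj).trans
    ((S.clusterEnergy_mono hm hj le_rfl).trans (S.energy_eq k).le)

end masses

/-- A bound for all heights and speeds. -/
noncomputable def bound (n : ℕ) (m : ℕ → ℝ) (c : ℝ) : ℝ := 1 + ∑ j ∈ Icc 0 n, 2 * c / m j

/-- A bound for all inverse masses. -/
noncomputable def invMass (n : ℕ) (m : ℕ → ℝ) : ℝ := 1 + ∑ j ∈ Icc 0 n, 1 / m j

section masses
variable (hm : ∀ j, 0 < m j)
include hm

theorem one_le_invMass : 1 ≤ invMass n m := by
  have : 0 ≤ ∑ j ∈ Icc 0 n, 1 / m j := sum_nonneg fun j _ => by have := hm j; positivity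
  unfold invMass; linarith

theorem inv_le_invMass {j : ℕ} (hj : j ≤ n) : 1 / m j ≤ invMass n m := by
  have := single_le_sum (f := fun j => 1 / m j) (s := Icc 0 n) (fun j _ => by
    have := hm j; positivity) (mem_Icc.2 ⟨Nat.zero_le j, hj⟩)
  unfold invMass; linarith

theorem one_le_bound (hc : 0 ≤ c) : 1 ≤ bound n m c := by
  have : 0 ≤ ∑ j ∈ Icc 0 n, 2 * c / m j := sum_nonneg fun j _ => by have := hm j; positivity
  unfold bound; linarith

theorem le_bound (hc : 0 ≤ c) {j : ℕ} (hj : j ≤ n) : 2 * c / m j ≤ bound n m c := by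
  have := single_le_sum (f := fun j => 2 * c / m j) (s := Icc 0 n) (fun j _ => by
    have := hm j; positivity) (mem_Icc.2 ⟨Nat.zero_le j, hj⟩)
  unfold bound; linarith

theorem sq_add_le (hc : 0 ≤ c) {j k : ℕ} (hj : j ≤ n) :
    S.v k j ^ 2 + 2 * S.q k j ≤ bound n m c := by
  refine le_trans ?_ (le_bound hm hc hj)
  rw [le_div_iff₀ (hm j)]
  linarith [S.ball_le_energy hm (k := k) hj]

theorem q_le (hc : 0 ≤ c) {j k : ℕ} (hj : j ≤ n) : S.q k j ≤ bound n m c := by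
  have := S.q_nonneg k j hj
  nlinarith [S.sq_add_le hm hc (k := k) hj, sq_nonneg (S.v k j)]

theorem abs_v_le (hc : 0 ≤ c) {j k : ℕ} (hj : j ≤ n) : |S.v k j| ≤ bound n m c := by
  have := S.q_nonneg k j hj
  have := one_le_bound (n := n) hm hc
  -- The summand `1` in `bound` makes it at most its own square, so one constant serves for heights
  -- and speeds.
  refine abs_le_of_sq_le_sq ?_ (by linarith)
  nlinarith [S.sq_add_le hm hc (k := k) hj]

theorem abs_u_le (hc : 0 ≤ c) {j k : ℕ} (hj : j ≤ n) : |S.u k j| ≤ bound n m c := by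
  have := S.q_nonneg (k + 1) j hj
  have := one_le_bound (n := n) hm hc
  refine abs_le_of_sq_le_sq ?_ (by linarith)
  nlinarith [S.sq_add_le hm hc (k := k) hj, S.fall_energy (k := k) hj]

omit hm in
theorem u_le_v {j k : ℕ} (hj : j ≤ n) : S.u k j ≤ S.v k j := by
  have := S.t_le k
  rcases S.fall k j hj with h | ⟨h, h'⟩
  · linarith
  · rw [h', (h j le_rfl).2]

omit hm in
theorem v_le_u_add {j k : ℕ} (hj : j ≤ n) : S.v k j ≤ S.u k j + (S.t (k + 1) - S.t k) := by
  have := S.t_le k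
  rcases S.fall k j hj with h | ⟨h, h'⟩
  · linarith
  · rw [h', (h j le_rfl).2]; linarith

omit hm in
/-- The top ball never rests, since the energy is positive. -/
theorem u_top (hc : 0 < c) (k : ℕ) : S.u k n = S.v k n - (S.t (k + 1) - S.t k) := by
  rcases S.fall k n le_rfl with h | ⟨h, -⟩
  · exact h
  · exfalso
    have := S.energy_eq k
    rw [sum_eq_zero fun j hj => by simp [h j (mem_Icc.1 hj).2]] at this
    exact hc.ne this

/-- The free fall of the top ball is a clock: its velocity drops by the elapsed time and stays in an
interval of length `2 * bound n m c`. -/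
theorem t_succ_le (hc : 0 < c) (k : ℕ) : S.t (k + 1) ≤ S.t k + 2 * bound n m c := by
  have h1 := abs_le.1 (S.abs_v_le hm hc.le (k := k) (le_refl n))
  have h2 := abs_le.1 (S.abs_u_le hm hc.le (k := k) (le_refl n))
  linarith [S.u_top hc k]

theorem abs_jump_le {j k : ℕ} (hj : j ≤ n) :
    |S.v (k + 1) j - S.u k j| ≤ invMass n m * S.J k := by
  have h := S.hit k j hj
  have hm' := hm j
  have hJ := S.J_pos k
  have h1 : |m j * (S.v (k + 1) j - S.u k j)| ≤ S.J k := by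
    rw [show m j * (S.v (k + 1) j - S.u k j) = (if S.W k = j then S.J k else 0) -
      (if S.W k = j + 1 then S.J k else 0) by linarith]
    split_ifs <;> first | omega | simp [abs_of_pos hJ, hJ.le]
  rw [abs_mul, abs_of_pos hm'] at h1
  calc _ ≤ S.J k / m j := by rw [le_div_iff₀ hm']; linarith
    _ = 1 / m j * S.J k := by ring
    _ ≤ _ := by gcongr; exact inv_le_invMass hm hj

theorem rel_le {k i : ℕ} (h : S.W k = i + 1) :
    |S.u k i - S.u k (i + 1)| ≤ invMass n m * S.J k := by
  have h1 := (S.pair k i h).1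
  have hn := S.W_le k
  have a := hm i
  have b := hm (i + 1)
  have hJ := S.J_pos k
  have ia := inv_le_invMass (n := n) hm (j := i) (by omega)
  have ib := inv_le_invMass (n := n) hm (j := i + 1) (by omega)
  have h2 : S.u k i - S.u k (i + 1) = (1 / m i + 1 / m (i + 1)) / 2 * S.J k := by
    field_simp
    linarith
  rw [h2, abs_of_nonneg (by positivity)]
  gcongr
  linarith

theorem floor_le {k : ℕ} (h : S.W k = 0) : |S.u k 0| ≤ invMass n m * S.J k := by
  have h1 := (S.floor k h).1
  have a := hm 0
  have hJ := S.J_pos k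
  have ia := inv_le_invMass (n := n) hm (j := 0) (by omega)
  have h2 : S.u k 0 = -(1 / m 0 / 2 * S.J k) := by
    field_simp
    linarith
  rw [h2, abs_neg, abs_of_nonneg (by positivity)]
  gcongr
  have : 0 < 1 / m 0 := by positivity
  linarith

end masses

/-! ### Counting collisions -/

theorem hits_split (w : ℕ) {a b d : ℕ} (hab : a ≤ b) (hbd : b ≤ d) :
    S.hits w a d = S.hits w a b + S.hits w b d := by
  unfold hits
  rw [← Ico_union_Ico_eq_Ico hab hbd, filter_union,
    card_union_of_disjoint (disjoint_filter_filter (Ico_disjoint_Ico_consecutive a b d))]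

theorem hits_succ (w a b : ℕ) (hab : a ≤ b) :
    S.hits w a (b + 1) = S.hits w a b + if S.W b = w then 1 else 0 := by
  rw [S.hits_split w hab (Nat.le_succ b)]
  congr 1
  unfold hits
  rw [Nat.Ico_succ_singleton, filter_singleton]
  split_ifs <;> simp

theorem hits_eq_zero {w a b : ℕ} (h : ∀ k ∈ Ico a b, S.W k ≠ w) : S.hits w a b = 0 := by
  unfold hits
  rw [card_eq_zero, filter_eq_empty_iff]
  exact h

theorem exists_hits_eq {w a N : ℕ} : ∀ {b}, a ≤ b → N ≤ S.hits w a b →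
    ∃ b', a ≤ b' ∧ b' ≤ b ∧ S.hits w a b' = N := by
  intro b hab
  induction b, hab using Nat.le_induction with
  | base => exact fun h => ⟨a, le_rfl, le_rfl, by simp [hits] at h ⊢; omega⟩
  | succ b hab ih =>
    intro h
    by_cases h1 : N ≤ S.hits w a b
    · obtain ⟨b', h2, h3, h4⟩ := ih h1
      exact ⟨b', h2, by omega, h4⟩
    · refine ⟨b + 1, by omega, le_rfl, le_antisymm ?_ h⟩
      rw [S.hits_succ w a b hab]
      split_ifs <;> omega

/-- Cut off successive pieces with exactly `N + 1` collisions `w`; each of the `L` pieces pays `ρ`.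
-/
theorem mul_le_sum_of_hits {w N : ℕ} {ψ : ℕ → ℝ} (hψ : ∀ k, 0 ≤ ψ k) {ρ : ℝ} {b : ℕ} :
    ∀ L {a : ℕ}, a ≤ b → (∀ a' b', a ≤ a' → a' ≤ b' → b' ≤ b → N < S.hits w a' b' →
      ρ ≤ ∑ k ∈ Ico a' b', ψ k) → (N + 1) * L ≤ S.hits w a b → L * ρ ≤ ∑ k ∈ Ico a b, ψ k := by
  intro L
  induction L with
  | zero => intro a _ _ _; simpa using sum_nonneg fun k _ => hψ k
  | succ L ih =>
    intro a hab h hL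
    obtain ⟨b', h1, h2, h3⟩ := S.exists_hits_eq (N := N + 1) hab (le_trans (by nlinarith) hL)
    have h4 := S.hits_split w h1 h2
    have h5 := ih h2 (fun a' b'' ha' => h a' b'' (h1.trans ha')) (by rw [h4, h3, mul_add] at hL; omega)
    have h6 := h a b' le_rfl h1 h2 (by omega)
    rw [← sum_Ico_consecutive _ h1 h2]
    push_cast
    linarith

/-- If every stretch with more than `N` collisions `w` costs at least `ρ`, a budget bounds their
number. -/
theorem hits_le_of_cost {w N L : ℕ} {ψ : ℕ → ℝ} (hψ : ∀ k, 0 ≤ ψ k) {ρ : ℝ} {a b : ℕ}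
    (hab : a ≤ b) (h : ∀ a' b', a ≤ a' → a' ≤ b' → b' ≤ b → N < S.hits w a' b' →
      ρ ≤ ∑ k ∈ Ico a' b', ψ k) (hL : ∑ k ∈ Ico a b, ψ k < L * ρ) :
    S.hits w a b ≤ (N + 1) * L := by
  by_contra! h1
  exact absurd (S.mul_le_sum_of_hits hψ L hab h h1.le) (not_le.2 hL)

end BallSeq
end FallingBalls

namespace FallingBalls

open Finset
namespace BallSeq

variable {n : ℕ} {m : ℕ → ℝ} {c : ℝ} (S : BallSeq n m c)

/-! ### Stretches with floor collisions -/

/-- The total momentum transferred and time elapsed over `[a, b)`. -/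
noncomputable def cost (a b : ℕ) : ℝ := ∑ k ∈ Ico a b, (S.J k + (S.t (k + 1) - S.t k))

theorem cost_term_nonneg (k : ℕ) : 0 ≤ S.J k + (S.t (k + 1) - S.t k) := by
  linarith [S.J_pos k, S.t_le k]

theorem cost_mono {a b a' b' : ℕ} (ha : a ≤ a') (hb : b' ≤ b) : S.cost a' b' ≤ S.cost a b :=
  sum_le_sum_of_subset_of_nonneg (Ico_subset_Ico ha hb) fun k _ _ => S.cost_term_nonneg k

theorem cost_term_le {a b k : ℕ} (hk : k ∈ Ico a b) :
    S.J k + (S.t (k + 1) - S.t k) ≤ S.cost a b :=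
  single_le_sum (f := fun k => S.J k + (S.t (k + 1) - S.t k))
    (fun k _ => S.cost_term_nonneg k) hk

theorem J_le_cost {a b k : ℕ} (hk : k ∈ Ico a b) : S.J k ≤ S.cost a b := by
  linarith [S.cost_term_le hk, S.t_le k]

theorem cost_succ {a b : ℕ} (hab : a ≤ b) :
    S.cost a (b + 1) = S.cost a b + (S.J b + (S.t (b + 1) - S.t b)) := by
  unfold cost
  rw [sum_Ico_succ_top hab]

section masses
variable (hm : ∀ j, 0 < m j)
include hm

omit hm in
theorem abs_u_sub_v_le {j k : ℕ} (hj : j ≤ n) :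
    |S.v k j - S.u k j| ≤ S.t (k + 1) - S.t k := by
  rw [abs_le]
  constructor <;> linarith [S.u_le_v (k := k) hj, S.v_le_u_add (k := k) hj, S.t_le k]

theorem abs_v_sub_le_cost {j a : ℕ} (hj : j ≤ n) : ∀ b, a ≤ b →
    |S.v a j - S.v b j| ≤ invMass n m * S.cost a b := by
  intro b hab
  induction b, hab using Nat.le_induction with
  | base => simp [cost]
  | succ b hab ih =>
    rw [S.cost_succ hab]
    have h1 := S.abs_jump_le hm (k := b) hj
    have h2 := S.abs_u_sub_v_le (k := b) hj
    have h3 := one_le_invMass (n := n) hm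
    rw [abs_le] at *
    have := S.t_le b
    constructor <;> nlinarith

theorem abs_v_sub_u_le_cost {j a b k : ℕ} (hj : j ≤ n) (hk : k ∈ Ico a b) :
    |S.v a j - S.u k j| ≤ invMass n m * S.cost a b := by
  obtain ⟨h1, h2⟩ := mem_Ico.1 hk
  have h3 := S.abs_v_sub_le_cost hm hj k h1
  have h4 := S.abs_u_sub_v_le (k := k) hj
  have h5 := one_le_invMass (n := n) hm
  have h6 := S.cost_mono (le_refl a) (show k + 1 ≤ b from h2)
  rw [S.cost_succ h1] at h6
  rw [abs_le] at *
  have := S.t_le k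
  have := S.J_pos k
  constructor <;> nlinarith

theorem abs_q_sub_le_cost (hc : 0 ≤ c) {j a : ℕ} (hj : j ≤ n) : ∀ b, a ≤ b →
    |S.q a j - S.q b j| ≤ bound n m c * S.cost a b := by
  intro b hab
  induction b, hab using Nat.le_induction with
  | base => simp [cost]
  | succ b hab ih =>
    rw [S.cost_succ hab, S.move b j hj]
    have h1 := S.abs_v_le hm hc (k := b) hj
    have h2 := S.abs_u_le hm hc (k := b) hj
    have h3 := one_le_bound (n := n) hm hc
    have := S.t_le b
    have := S.J_pos b
    rw [abs_le] at *
    constructor <;> nlinarith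

/-- A floor collision with small impulse means that the bottom ball is slow, a pair collision with
small impulse that the two velocities are close. Chaining these up from the floor controls every
ball; the drift since index `a` is also paid for by the cost. -/
theorem cluster_v_le {r a b : ℕ} (hr : r ≤ n) (h : ∀ x ≤ r, ∃ k ∈ Ico a b, S.W k = x) :
    ∀ j ≤ r, |S.v a j| ≤ 3 * (j + 1) * (invMass n m * S.cost a b) := by
  intro j
  induction j with
  | zero =>
    intro _
    obtain ⟨k, hk, hW⟩ := h 0 (Nat.zero_le r)
    have h1 := S.floor_le hm hW
    have h2 := S.abs_v_sub_u_le_cost hm (Nat.zero_le n) hk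
    have h3 := mul_le_mul_of_nonneg_left (S.J_le_cost hk)
      (zero_le_one.trans (one_le_invMass (n := n) hm))
    have h4 := abs_nonneg (S.u k 0)
    rw [abs_le] at *
    push_cast
    constructor <;> linarith
  | succ i ih =>
    intro hi
    have ih := ih (by omega)
    obtain ⟨k, hk, hW⟩ := h (i + 1) hi
    have h1 := S.rel_le hm hW
    have h2 := S.abs_v_sub_u_le_cost hm (j := i) (by omega) hk
    have h2' := S.abs_v_sub_u_le_cost hm (j := i + 1) (by omega) hk
    have h3 := mul_le_mul_of_nonneg_left (S.J_le_cost hk)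
      (zero_le_one.trans (one_le_invMass (n := n) hm))
    rw [abs_le] at *
    push_cast at *
    constructor <;> linarith

theorem cluster_q_le (hc : 0 ≤ c) {r a b : ℕ} (hr : r ≤ n)
    (h : ∀ x ≤ r, ∃ k ∈ Ico a b, S.W k = x) :
    ∀ j ≤ r, S.q a j ≤ 2 * (j + 1) * (bound n m c * S.cost a b) := by
  have hV := one_le_bound (n := n) hm hc
  have hq : ∀ j ≤ n, ∀ k ∈ Ico a b, |S.q a j - S.q (k + 1) j| ≤ bound n m c * S.cost a b := by
    intro j hj k hk
    obtain ⟨h1, h2⟩ := mem_Ico.1 hk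
    exact (S.abs_q_sub_le_cost hm hc hj (k + 1) (by omega)).trans
      (mul_le_mul_of_nonneg_left (S.cost_mono le_rfl h2) (by linarith))
  intro j
  induction j with
  | zero =>
    intro _
    obtain ⟨k, hk, hW⟩ := h 0 (Nat.zero_le r)
    have h1 := (S.floor k hW).2
    have h2 := hq 0 (Nat.zero_le n) k hk
    rw [abs_le] at h2
    push_cast
    linarith
  | succ i ih =>
    intro hi
    have ih := ih (by omega)
    obtain ⟨k, hk, hW⟩ := h (i + 1) hi
    have h1 := (S.pair k i hW).2
    have h2 := hq i (by omega) k hk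
    have h3 := hq (i + 1) (by omega) k hk
    rw [abs_le] at h2 h3
    push_cast
    linarith

/-- A stretch in which the floor and all of the balls `0, …, r` collide costs a definite amount. -/
theorem clusterEnergy_le_cost (hc : 0 ≤ c) {r a b : ℕ} (hr : r ≤ n)
    (h : ∀ x ≤ r, ∃ k ∈ Ico a b, S.W k = x) :
    S.clusterEnergy a r ≤
      (∑ j ∈ Icc 0 n, m j * (4 * (j + 1) * bound n m c * invMass n m)) * S.cost a b := by
  have hV := one_le_bound (n := n) hm hc
  have hA := one_le_invMass (n := n) hm
  have hΦ : 0 ≤ S.cost a b := sum_nonneg fun k _ => S.cost_term_nonneg k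
  have h0 : S.clusterEnergy a r ≤
      ∑ j ∈ Icc 0 r, m j * (4 * (j + 1) * bound n m c * invMass n m) * S.cost a b := by
    refine sum_le_sum fun j hj => ?_
    have hj' := (mem_Icc.1 hj).2
    have h1 := S.cluster_v_le hm hr h j hj'
    have h2 := S.cluster_q_le hm hc hr h j hj'
    have h3 := S.abs_v_le hm hc (k := a) (hj'.trans hr)
    have h4 : S.v a j ^ 2 ≤ bound n m c * (3 * (j + 1) * (invMass n m * S.cost a b)) := by
      rw [← sq_abs, sq]
      exact mul_le_mul h3 h1 (abs_nonneg _) (by linarith)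
    rw [mul_assoc (m j)]
    refine mul_le_mul_of_nonneg_left ?_ (hm j).le
    have h5 : 2 * ((j : ℝ) + 1) * (bound n m c * S.cost a b) ≤
        2 * (j + 1) * (bound n m c * S.cost a b) * invMass n m :=
      le_mul_of_one_le_right (by positivity) hA
    have h6 : 0 ≤ ((j : ℝ) + 1) * bound n m c * invMass n m * S.cost a b := by positivity
    nlinarith
  refine h0.trans ?_
  rw [← sum_mul]
  refine mul_le_mul_of_nonneg_right ?_ hΦ
  refine sum_le_sum_of_subset_of_nonneg (Icc_subset_Icc_right hr) fun j _ _ => ?_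
  have := hm j
  positivity

/-- The momentum transferred in bounded time is bounded. -/
theorem cost_le (hc : 0 ≤ c) {a b : ℕ} (hab : a ≤ b) :
    S.cost a b ≤ (∑ j ∈ Icc 0 n, (j + 1) * m j) * (2 * bound n m c + (S.t b - S.t a)) +
      (S.t b - S.t a) := by
  set M : ℝ := ∑ j ∈ Icc 0 n, (j + 1) * m j with hM
  -- With the weights `j + 1` every collision, the floor included, raises this momentum by exactly
  -- `J k`. It is bounded, and gravity lowers it at rate at most `M`.
  set F : ℕ → ℝ := fun k => ∑ j ∈ Icc 0 n, (j + 1) * (m j * S.v k j) with hF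
  have hb : ∀ k, |F k| ≤ M * bound n m c := by
    intro k
    refine (abs_sum_le_sum_abs _ _).trans ?_
    rw [hM, sum_mul]
    refine sum_le_sum fun j hj => ?_
    have h1 := S.abs_v_le hm hc (k := k) (mem_Icc.1 hj).2
    have := hm j
    rw [abs_mul, abs_mul, abs_of_pos this, abs_of_nonneg (by positivity : (0 : ℝ) ≤ j + 1),
      mul_assoc]
    gcongr
  have hs : ∀ k, S.J k ≤ F (k + 1) - F k + M * (S.t (k + 1) - S.t k) := by
    intro k
    have h1 := S.sum_mul_jump (fun j => (j : ℝ) + 1) le_rfl (Nat.zero_le n) (k := k)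
      (by have := S.W_le k; omega)
    have h2 : S.J k = ∑ j ∈ Icc 0 n, ((j : ℝ) + 1) * (m j * S.v (k + 1) j - m j * S.u k j) := by
      rw [h1]
      have := S.W_le k
      split_ifs with h3 h4
      · simp
      · rw [Nat.cast_sub (by omega)]; push_cast; ring
      · omega
    rw [h2, hF, hM, ← sum_sub_distrib, sum_mul, ← sum_add_distrib]
    refine sum_le_sum fun j hj => ?_
    have h5 := S.v_le_u_add (k := k) (mem_Icc.1 hj).2
    have := hm j
    have h6 : ((j : ℝ) + 1) * (m j * S.v k j) ≤
      (j + 1) * (m j * (S.u k j + (S.t (k + 1) - S.t k))) := by gcongr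
    nlinarith
  have h3 : S.cost a b ≤ F b - F a + (M + 1) * (S.t b - S.t a) := by
    induction b, hab using Nat.le_induction with
    | base => simp [cost]
    | succ b hab ih =>
      rw [S.cost_succ hab]
      linarith [hs b]
  have h4 := abs_le.1 (hb a)
  have h5 := abs_le.1 (hb b)
  linarith

/-- The number of collisions `w` in a stretch with floor collisions. -/
theorem exists_hits_le_floor (hc : 0 ≤ c) {r w : ℕ} (hr : r ≤ n) (hw : w ≤ r) {T E : ℝ}
    (hE : 0 < E) (N : ℕ) : ∃ N', ∀ (S : BallSeq n m c) (a b : ℕ), a ≤ b → S.t b - S.t a ≤ T →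
      (∀ k ∈ Ico a b, E ≤ S.clusterEnergy k w) →
      (∀ a' b', a ≤ a' → b' ≤ b → ∀ x ≤ r, (∀ k ∈ Ico a' b', S.W k ≠ x) → S.hits w a' b' ≤ N) →
      S.hits w a b ≤ N' := by
  set K : ℝ := ∑ j ∈ Icc 0 n, m j * (4 * (j + 1) * bound n m c * invMass n m)
  set M : ℝ := ∑ j ∈ Icc 0 n, (j + 1) * m j
  have hV := one_le_bound (n := n) hm hc
  have hA := one_le_invMass (n := n) hm
  have hK : 0 < K := sum_pos (fun j _ => by have := hm j; positivity) ⟨0, by simp⟩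
  have hM : 0 ≤ M := sum_nonneg fun j _ => by have := hm j; positivity
  -- The budget from `cost_le` divided by the least price `E / K` of a stretch in which all
  -- collisions `0, …, r` occur.
  obtain ⟨L, hL⟩ := exists_nat_gt ((M * (2 * bound n m c + T) + T) / (E / K))
  rw [div_lt_iff₀ (by positivity)] at hL
  refine ⟨(N + 1) * L, fun S a b hab hT hE' h => ?_⟩
  refine S.hits_le_of_cost S.cost_term_nonneg hab (ρ := E / K) (fun a' b' h1 h2 h3 h4 => ?_) ?_
  · have hfull : ∀ x ≤ r, ∃ k ∈ Ico a' b', S.W k = x := by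
      intro x hx
      by_contra! h5
      exact absurd (h a' b' h1 h3 x hx h5) (not_le.2 h4)
    have h5 := S.clusterEnergy_le_cost hm hc hr hfull
    obtain ⟨k, hk, -⟩ := hfull 0 (Nat.zero_le r)
    have hk := mem_Ico.1 hk
    have h6 := hE' a' (mem_Ico.2 ⟨h1, by omega⟩)
    have h7 := S.clusterEnergy_mono hm (k := a') hw hr
    rw [div_le_iff₀ hK]
    change E ≤ S.cost a' b' * K
    linarith
  · refine lt_of_le_of_lt (S.cost_le hm hc hab) (lt_of_le_of_lt ?_ hL)
    have : 0 ≤ S.t b - S.t a := by linarith [S.t_mono hab]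
    gcongr

end masses

end BallSeq
end FallingBalls

namespace FallingBalls

open Finset
namespace BallSeq

variable {n : ℕ} {m : ℕ → ℝ} {c : ℝ} (S : BallSeq n m c)

/-! ### Stretches without floor collisions -/

/-- The Galilei invariant kinetic energy of the balls `α, …, β` relative to their center of mass. -/
def spread (m : ℕ → ℝ) (α β : ℕ) (x : ℕ → ℝ) : ℝ :=
  ∑ i ∈ Icc α β, ∑ j ∈ Icc α β, m i * m j * (x i - x j) ^ 2

/-- A Galilei invariant momentum that grows with every collision. -/
def lift (m : ℕ → ℝ) (α β : ℕ) (x : ℕ → ℝ) : ℝ :=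
  ∑ i ∈ Icc α β, ∑ j ∈ Icc α β, i * (m i * m j * (x i - x j))

theorem spread_eq (m : ℕ → ℝ) (α β : ℕ) (x : ℕ → ℝ) :
    spread m α β x = 2 * ((∑ i ∈ Icc α β, m i) * ∑ i ∈ Icc α β, m i * x i ^ 2) -
      2 * (∑ i ∈ Icc α β, m i * x i) ^ 2 := by
  have h : ∀ i j, m i * m j * (x i - x j) ^ 2 =
      (m i * x i ^ 2) * m j + m i * (m j * x j ^ 2) - 2 * ((m i * x i) * (m j * x j)) :=
    fun i j => by ring
  simp only [spread, h, sum_sub_distrib, sum_add_distrib, ← mul_sum, ← sum_mul]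
  ring

theorem lift_eq (m : ℕ → ℝ) (α β : ℕ) (x : ℕ → ℝ) :
    lift m α β x = (∑ i ∈ Icc α β, m i) * (∑ i ∈ Icc α β, i * (m i * x i)) -
      (∑ i ∈ Icc α β, i * m i) * (∑ i ∈ Icc α β, m i * x i) := by
  have h : ∀ i j : ℕ, (i : ℝ) * (m i * m j * (x i - x j)) =
      (i * (m i * x i)) * m j - (i * m i) * (m j * x j) := fun i j => by ring
  simp only [lift, h, sum_sub_distrib, ← mul_sum, ← sum_mul]
  ring

theorem spread_congr {m : ℕ → ℝ} {α β : ℕ} {x y : ℕ → ℝ} {d : ℝ}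
    (h : ∀ j ∈ Icc α β, x j = y j - d) : spread m α β x = spread m α β y :=
  sum_congr rfl fun i hi => sum_congr rfl fun j hj => by rw [h i hi, h j hj]; ring

theorem lift_congr {m : ℕ → ℝ} {α β : ℕ} {x y : ℕ → ℝ} {d : ℝ}
    (h : ∀ j ∈ Icc α β, x j = y j - d) : lift m α β x = lift m α β y :=
  sum_congr rfl fun i hi => sum_congr rfl fun j hj => by rw [h i hi, h j hj]; ring

theorem spread_nonneg {m : ℕ → ℝ} (hm : ∀ j, 0 < m j) (α β : ℕ) (x : ℕ → ℝ) :
    0 ≤ spread m α β x :=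
  sum_nonneg fun i _ => sum_nonneg fun j _ => by have := hm i; have := hm j; positivity

section masses
variable (hm : ∀ j, 0 < m j)
include hm

theorem sq_sub_le_spread {α β : ℕ} (hβ : β ≤ n) (x : ℕ → ℝ) {i j : ℕ} (hi : i ∈ Icc α β)
    (hj : j ∈ Icc α β) : (x i - x j) ^ 2 ≤ invMass n m ^ 2 * spread m α β x := by
  have h0 : ∀ i j, 0 ≤ m i * m j * (x i - x j) ^ 2 := fun i j => by
    have := hm i; have := hm j; positivity
  have h1 : m i * m j * (x i - x j) ^ 2 ≤ spread m α β x :=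
    (single_le_sum (f := fun j => m i * m j * (x i - x j) ^ 2) (fun j _ => h0 i j) hj).trans
      (single_le_sum (f := fun i => ∑ j ∈ Icc α β, m i * m j * (x i - x j) ^ 2)
        (fun i _ => sum_nonneg fun j _ => h0 i j) hi)
  have h2 := inv_le_invMass (n := n) hm ((mem_Icc.1 hi).2.trans hβ)
  have h3 := inv_le_invMass (n := n) hm ((mem_Icc.1 hj).2.trans hβ)
  have hi' := hm i
  have hj' := hm j
  calc (x i - x j) ^ 2 = (1 / m i * (1 / m j)) * (m i * m j * (x i - x j) ^ 2) := by
        field_simp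
    _ ≤ (invMass n m * invMass n m) * (m i * m j * (x i - x j) ^ 2) := by
        gcongr
        exact zero_le_one.trans (one_le_invMass hm)
    _ ≤ _ := by rw [sq (invMass n m)]; exact mul_le_mul_of_nonneg_left h1 (mul_self_nonneg _)

theorem abs_lift_le {α β : ℕ} (hβ : β ≤ n) (x : ℕ → ℝ) :
    |lift m α β x| ≤ (∑ i ∈ Icc α β, ∑ j ∈ Icc α β, i * (m i * m j)) *
      (invMass n m * √(spread m α β x)) := by
  refine (abs_sum_le_sum_abs _ _).trans ?_
  rw [sum_mul]
  refine sum_le_sum fun i hi => (abs_sum_le_sum_abs _ _).trans ?_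
  rw [sum_mul]
  refine sum_le_sum fun j hj => ?_
  have := hm i
  have := hm j
  have hA := one_le_invMass (n := n) hm
  have h1 : |x i - x j| ≤ invMass n m * √(spread m α β x) := by
    refine abs_le_of_sq_le_sq ?_ (by positivity)
    rw [mul_pow, Real.sq_sqrt (spread_nonneg hm _ _ _)]
    exact sq_sub_le_spread hm hβ x hi hj
  rw [abs_mul, abs_mul, abs_of_nonneg (by positivity : (0 : ℝ) ≤ i),
    abs_of_pos (by positivity : 0 < m i * m j), mul_assoc (i : ℝ)]
  gcongr

theorem spread_hit {α β k : ℕ} (hβ : β ≤ n) (hαβ : α ≤ β) (h : S.W k ≠ β + 1)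
    (hα : S.W k ≠ α) : spread m α β (S.v (k + 1)) = spread m α β (S.u k) := by
  have h1 := S.sum_sq_jump hm hβ hαβ h (fun h => absurd h hα)
  have h2 := S.sum_mul_jump (fun _ => 1) hβ hαβ h
  simp only [one_mul, sub_self, mul_zero, ite_self, if_neg hα, sum_sub_distrib, sub_eq_zero] at h2
  rw [spread_eq, spread_eq, h1, h2]

omit hm in
theorem lift_hit {α β k : ℕ} (hβ : β ≤ n) (hαβ : α ≤ β) (h : S.W k ≠ β + 1)
    (hα : S.W k ≠ α) : lift m α β (S.v (k + 1)) = lift m α β (S.u k) +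
      (∑ i ∈ Icc α β, m i) * if α < S.W k ∧ S.W k ≤ β then S.J k else 0 := by
  have h1 := S.sum_mul_jump (fun j => (j : ℝ)) hβ hαβ h
  have h2 := S.sum_mul_jump (fun _ => 1) hβ hαβ h
  simp only [one_mul, sub_self, mul_zero, ite_self, if_neg hα, sum_sub_distrib, sub_eq_zero] at h2
  have h3 : (∑ j ∈ Icc α β, (j : ℝ) * (m j * S.v (k + 1) j)) -
      ∑ j ∈ Icc α β, (j : ℝ) * (m j * S.u k j) =
        if α < S.W k ∧ S.W k ≤ β then S.J k else 0 := by
    rw [← sum_sub_distrib]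
    rw [sum_congr rfl fun (j : ℕ) _ => (mul_sub (j : ℝ) (m j * S.v (k + 1) j) (m j * S.u k j)).symm, h1,
      if_neg hα]
    split_ifs with h4
    · rw [Nat.cast_sub (by omega)]; push_cast; ring
    · rfl
  rw [lift_eq, lift_eq, h2, ← h3]
  ring

/-- The momentum transferred between the balls `α, …, β` by the next collision. -/
noncomputable def inner (α β k : ℕ) : ℝ := if α < S.W k ∧ S.W k ≤ β then S.J k else 0

omit hm in
theorem inner_nonneg (α β k : ℕ) : 0 ≤ S.inner α β k := by
  unfold inner
  split_ifs
  exacts [(S.J_pos k).le, le_rfl]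

/-- On `[a, b)` the balls `α, …, β` fall freely and collide only with each other. -/
def Free (α β a b : ℕ) : Prop :=
  ∀ k ∈ Ico a b, S.W k ≠ α ∧ S.W k ≠ β + 1 ∧
    ∀ j ∈ Icc α β, S.u k j = S.v k j - (S.t (k + 1) - S.t k)

omit hm in
theorem Free.mono {S : BallSeq n m c} {α β a b a' b' : ℕ} (h : S.Free α β a b) (ha : a ≤ a')
    (hb : b' ≤ b) : S.Free α β a' b' := fun k hk => h k (Ico_subset_Ico ha hb hk)

theorem Free.spread_eq {S : BallSeq n m c} {α β a b : ℕ} (hβ : β ≤ n) (hαβ : α ≤ β)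
    (hab : a ≤ b) (h : S.Free α β a b) :
    spread m α β (S.v b) = spread m α β (S.v a) := by
  induction b, hab using Nat.le_induction with
  | base => rfl
  | succ b hab ih =>
    obtain ⟨h1, h2, h3⟩ := h b (by simp [hab])
    rw [S.spread_hit hm hβ hαβ h2 h1, spread_congr h3, ih (h.mono le_rfl (Nat.le_succ b))]

omit hm in
theorem Free.lift_eq {S : BallSeq n m c} {α β a b : ℕ} (hβ : β ≤ n) (hαβ : α ≤ β)
    (hab : a ≤ b) (h : S.Free α β a b) : lift m α β (S.v b) = lift m α β (S.v a) +
      (∑ i ∈ Icc α β, m i) * ∑ k ∈ Ico a b, S.inner α β k := by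
  induction b, hab using Nat.le_induction with
  | base => simp
  | succ b hab ih =>
    obtain ⟨h1, h2, h3⟩ := h b (by simp [hab])
    rw [S.lift_hit hβ hαβ h2 h1, lift_congr h3, ih (h.mono le_rfl (Nat.le_succ b)),
      sum_Ico_succ_top hab, inner]
    ring

theorem Free.abs_sub_le {S : BallSeq n m c} {α β a b : ℕ} (hβ : β ≤ n) (hab : a ≤ b)
    (h : S.Free α β a b) {i j : ℕ} (hi : i ∈ Icc α β) (hj : j ∈ Icc α β) :
    |(S.v b i - S.v b j) - (S.v a i - S.v a j)| ≤
      2 * invMass n m * ∑ k ∈ Ico a b, S.inner α β k := by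
  induction b, hab using Nat.le_induction with
  | base => simp
  | succ b hab ih =>
    obtain ⟨h1, h2, h3⟩ := h b (by simp [hab])
    have ih := ih (h.mono le_rfl (Nat.le_succ b))
    have hjump : ∀ j ∈ Icc α β, |S.v (b + 1) j - S.u b j| ≤ invMass n m * S.inner α β b := by
      intro j hj
      obtain ⟨h4, h5⟩ := mem_Icc.1 hj
      unfold inner
      split_ifs with h6
      · exact S.abs_jump_le hm (h5.trans hβ)
      · have h7 := S.hit b j (h5.trans hβ)
        rw [if_neg (by omega), if_neg (by omega), add_zero, sub_zero] at h7
        rw [mul_left_cancel₀ (hm j).ne' h7]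
        simp
    have h4 := hjump i hi
    have h5 := hjump j hj
    rw [h3 i hi] at h4
    rw [h3 j hj] at h5
    rw [sum_Ico_succ_top hab]
    rw [abs_le] at *
    constructor <;> linarith

/-- A free stretch in which all neighbours collide costs a definite fraction of the spread. -/
theorem Free.spread_le {S : BallSeq n m c} {α β a b : ℕ} (hβ : β ≤ n)
    (h : S.Free α β a b) (hfull : ∀ x ∈ Ioc α β, ∃ k ∈ Ico a b, S.W k = x) :
    spread m α β (S.v a) ≤ (∑ i ∈ Icc α β, ∑ j ∈ Icc α β, m i * m j) *
      (6 * (n + 1) * invMass n m * ∑ k ∈ Ico a b, S.inner α β k) ^ 2 := by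
  set Φ := ∑ k ∈ Ico a b, S.inner α β k
  have hΦ : 0 ≤ Φ := sum_nonneg fun k _ => S.inner_nonneg α β k
  have hA := one_le_invMass (n := n) hm
  have h1 : ∀ i, α ≤ i → i < β → |S.v a i - S.v a (i + 1)| ≤ 3 * invMass n m * Φ := by
    intro i hi hi'
    obtain ⟨k, hk, hW⟩ := hfull (i + 1) (mem_Ioc.2 ⟨by omega, hi'⟩)
    have hk' := mem_Ico.1 hk
    have e1 : i ∈ Icc α β := mem_Icc.2 ⟨hi, hi'.le⟩
    have e2 : i + 1 ∈ Icc α β := mem_Icc.2 ⟨by omega, hi'⟩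
    have h2 := (h.mono le_rfl hk'.2.le).abs_sub_le hm hβ hk'.1 e1 e2
    have h3 : ∑ l ∈ Ico a k, S.inner α β l ≤ Φ :=
      sum_le_sum_of_subset_of_nonneg (Ico_subset_Ico_right hk'.2.le)
        fun l _ _ => S.inner_nonneg α β l
    have h4 : S.J k ≤ Φ := by
      have := single_le_sum (f := S.inner α β) (fun l _ => S.inner_nonneg α β l) hk
      rwa [inner, if_pos (by omega)] at this
    have h5 := S.rel_le hm hW
    rw [(h k hk).2.2 i e1, (h k hk).2.2 (i + 1) e2] at h5
    have h6 := mul_le_mul_of_nonneg_left h3 (show 0 ≤ 2 * invMass n m by linarith)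
    have h7 := mul_le_mul_of_nonneg_left h4 (show 0 ≤ invMass n m by linarith)
    rw [abs_le] at *
    constructor <;> linarith
  have h2 : ∀ j, α ≤ j → j ≤ β →
      |S.v a α - S.v a j| ≤ ((j - α : ℕ) : ℝ) * (3 * invMass n m * Φ) := by
    intro j hj
    induction j, hj using Nat.le_induction with
    | base => simp
    | succ i hi ih =>
      intro hi'
      have h3 := ih (by omega)
      have h4 := h1 i hi (by omega)
      rw [Nat.succ_sub hi]
      push_cast
      rw [abs_le] at *
      constructor <;> linarith
  have h3 : ∀ j ∈ Icc α β, |S.v a α - S.v a j| ≤ ((n : ℝ) + 1) * (3 * invMass n m * Φ) := by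
    intro j hj
    have h4 := mem_Icc.1 hj
    refine (h2 j h4.1 h4.2).trans ?_
    gcongr
    have : j - α ≤ n + 1 := by omega
    exact_mod_cast this
  rw [spread, sum_mul]
  refine sum_le_sum fun i hi => ?_
  rw [sum_mul]
  refine sum_le_sum fun j hj => ?_
  have := hm i
  have := hm j
  gcongr m i * m j * ?_
  rw [← sq_abs]
  gcongr
  have h4 := h3 i hi
  have h5 := h3 j hj
  rw [abs_le] at *
  constructor <;> linarith

/-- The number of collisions `w` in a free stretch. -/
theorem exists_hits_le_free {α β w : ℕ} (hβ : β ≤ n) (hw : w ∈ Ioc α β) (N : ℕ) :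
    ∃ N', ∀ (S : BallSeq n m c) (a b : ℕ), a ≤ b → S.Free α β a b →
      (∀ a' b', a ≤ a' → b' ≤ b → ∀ x ∈ Ioc α β, (∀ k ∈ Ico a' b', S.W k ≠ x) →
        S.hits w a' b' ≤ N) →
      S.hits w a b ≤ N' := by
  have hαβ : α ≤ β := by have := mem_Ioc.1 hw; omega
  have hA := one_le_invMass (n := n) hm
  set M : ℝ := ∑ i ∈ Icc α β, m i
  set P : ℝ := ∑ i ∈ Icc α β, ∑ j ∈ Icc α β, m i * m j
  set Q : ℝ := ∑ i ∈ Icc α β, ∑ j ∈ Icc α β, i * (m i * m j)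
  have hne : (Icc α β).Nonempty := ⟨α, by simp [hαβ]⟩
  have hM : 0 < M := sum_pos (fun j _ => hm j) hne
  have hP : 0 < P := sum_pos (fun i _ => sum_pos (fun j _ => mul_pos (hm i) (hm j)) hne) hne
  set K : ℝ := √P * (6 * (n + 1) * invMass n m) with hK
  have hK0 : 0 < K := by positivity
  -- Budget and price are both proportional to the root `R` of the conserved spread, so `L` depends
  -- neither on `R` nor on the duration. This is why no lower energy bound is needed away from the
  -- floor.
  obtain ⟨L, hL⟩ := exists_nat_gt (2 * Q * invMass n m / M * K)
  refine ⟨(N + 1) * L, fun S a b hab hfree h => ?_⟩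
  by_cases h0 : S.hits w a b = 0
  · omega
  set R := √(spread m α β (S.v a)) with hR
  -- If the spread vanished, all relative velocities would vanish and no collision with positive
  -- impulse could occur.
  have hR0 : 0 < R := by
    obtain ⟨k, hkf⟩ := card_ne_zero.1 h0
    obtain ⟨hk, hW⟩ := mem_filter.1 hkf
    obtain ⟨i, rfl⟩ : ∃ i, w = i + 1 := ⟨w - 1, by have := mem_Ioc.1 hw; omega⟩
    have hk' := mem_Ico.1 hk
    have hw' := mem_Ioc.1 hw
    have e1 : i ∈ Icc α β := mem_Icc.2 (by omega)
    have e2 : i + 1 ∈ Icc α β := mem_Icc.2 (by omega)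
    have h1 := sq_sub_le_spread hm hβ (S.u k) e1 e2
    rw [spread_congr (hfree k hk).2.2,
      (hfree.mono le_rfl hk'.2.le).spread_eq hm hβ hαβ hk'.1] at h1
    rw [hR, Real.sqrt_pos]
    by_contra! h2
    have h3 : S.u k i - S.u k (i + 1) = 0 := by
      have := mul_nonpos_of_nonneg_of_nonpos (sq_nonneg (invMass n m)) h2
      exact pow_eq_zero_iff two_ne_zero |>.1 (le_antisymm (h1.trans this) (sq_nonneg _))
    have h4 := (S.pair k i hW).1
    rw [h3, mul_zero] at h4
    have := mul_pos (S.J_pos k) (add_pos (hm i) (hm (i + 1)))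
    linarith
  refine S.hits_le_of_cost (S.inner_nonneg α β) hab (ρ := R / K) (fun a' b' h1 h2 h3 h4 => ?_) ?_
  · have h5 := (hfree.mono h1 h3).spread_le hm hβ (fun x hx => by
      by_contra! h5
      exact absurd (h a' b' h1 h3 x hx h5) (not_le.2 h4))
    rw [(hfree.mono le_rfl (h2.trans h3)).spread_eq hm hβ hαβ h1] at h5
    have h6 := Real.sqrt_le_sqrt h5
    have h7 : 0 ≤ ∑ k ∈ Ico a' b', S.inner α β k := sum_nonneg fun k _ => S.inner_nonneg α β k
    rw [Real.sqrt_mul hP.le, Real.sqrt_sq (by positivity)] at h6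
    rw [div_le_iff₀ hK0, hK]
    calc R ≤ _ := h6
      _ = _ := by ring
  · have h1 := hfree.lift_eq hβ hαβ hab
    have h2 := abs_le.1 (abs_lift_le hm hβ (S.v a) (α := α))
    have h3 := abs_le.1 (abs_lift_le hm hβ (S.v b) (α := α))
    rw [hfree.spread_eq hm hβ hαβ hab] at h3
    have h4 : M * ∑ k ∈ Ico a b, S.inner α β k ≤ 2 * Q * invMass n m * R := by
      change lift m α β (S.v b) = _ + M * _ at h1
      change _ ∧ _ ≤ Q * (_ * R) at h3
      change -(Q * (_ * R)) ≤ _ ∧ _ at h2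
      linarith
    calc ∑ k ∈ Ico a b, S.inner α β k ≤ 2 * Q * invMass n m * R / M := by
          rw [le_div_iff₀ hM]; linarith
      _ = (2 * Q * invMass n m / M * K) * (R / K) := by field_simp
      _ < L * (R / K) := by gcongr

end masses

end BallSeq
end FallingBalls

namespace FallingBalls

open Finset
namespace BallSeq

variable {n : ℕ} {m : ℕ → ℝ} {c : ℝ} (S : BallSeq n m c)

/-! ### Balls at rest -/

/-- The balls `0, …, j` rest on the floor. -/
def Rest (k j : ℕ) : Prop := ∀ i ≤ j, S.q k i = 0 ∧ S.v k i = 0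

section masses
variable (hm : ∀ j, 0 < m j)
include hm

omit hm in
theorem Rest.u_eq {S : BallSeq n m c} {k j : ℕ} (h : S.Rest k j) (hj : j ≤ n) {i : ℕ}
    (hi : i ≤ j) : S.u k i = 0 := by
  rcases S.fall k i (hi.trans hj) with h1 | h1
  · have h2 := S.move k i (hi.trans hj)
    have h3 := S.q_nonneg (k + 1) i (hi.trans hj)
    rw [(h i hi).2] at h1 h2
    rw [(h i hi).1] at h2
    nlinarith
  · exact h1.2

omit hm in
theorem Rest.lt_W {S : BallSeq n m c} {k j : ℕ} (h : S.Rest k j) (hj : j ≤ n)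
    (hm : ∀ j, 0 < m j) : j < S.W k := by
  by_contra! h1
  have hJ := S.J_pos k
  rcases hW : S.W k with _ | i
  · have := (S.floor k hW).1
    rw [h.u_eq hj (Nat.zero_le j)] at this
    linarith
  · have := (S.pair k i hW).1
    rw [h.u_eq hj (i := i) (by omega), h.u_eq hj (i := i + 1) (by omega), sub_self, mul_zero] at this
    have := mul_pos hJ (add_pos (hm i) (hm (i + 1)))
    linarith

theorem Rest.succ {S : BallSeq n m c} {k j : ℕ} (h : S.Rest k j) (hj : j ≤ n)
    (hW : S.W k ≠ j + 1) : S.Rest (k + 1) j := by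
  intro i hi
  have h0 := h.lt_W hj hm
  have h1 := S.hit k i (hi.trans hj)
  have h2 := S.move k i (hi.trans hj)
  rw [h.u_eq hj hi, if_neg (by omega), if_neg (by omega)] at h1
  rw [h.u_eq hj hi, (h i hi).1, (h i hi).2] at h2
  refine ⟨by rw [h2]; ring, ?_⟩
  rw [mul_zero, add_zero, sub_zero] at h1
  exact (mul_eq_zero.1 h1).resolve_left (hm i).ne'

theorem Rest.succ_of_hit {S : BallSeq n m c} {k j : ℕ} (h : S.Rest k j) (hj : j ≤ n)
    (hW : S.W k = j + 1) : S.q (k + 1) j = 0 ∧ S.v (k + 1) j < 0 := by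
  have h1 := S.hit k j hj
  have h2 := S.move k j hj
  rw [h.u_eq hj le_rfl, if_neg (by omega), if_pos hW] at h1
  rw [h.u_eq hj le_rfl, (h j le_rfl).1, (h j le_rfl).2] at h2
  refine ⟨by rw [h2]; ring, ?_⟩
  have := S.J_pos k
  have := hm j
  by_contra! h3
  nlinarith

/-- A ball pressed against the floor stops the clock until it is hit from below; a hit from above
only presses it harder. -/
theorem pressed_succ {k j : ℕ} (hj : j ≤ n) (hq : S.q k j = 0) (hv : S.v k j < 0)
    (hW : S.W k ≠ j) : S.q (k + 1) j = 0 ∧ S.v (k + 1) j < 0 := by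
  have h0 := S.frozen k j hj hq hv
  have h1 := S.hit k j hj
  have h2 := S.move k j hj
  rw [h0, sub_self, zero_mul, add_zero, hq] at h2
  refine ⟨h2, ?_⟩
  have h3 := S.u_le_v (k := k) hj
  rw [if_neg hW] at h1
  have h4 := hm j
  have h5 := S.J_pos k
  by_contra! h6
  have h7 : 0 ≤ m j * S.v (k + 1) j := by positivity
  have h8 : m j * S.u k j < 0 := mul_neg_of_pos_of_neg h4 (by linarith)
  split_ifs at h1 <;> linarith

omit hm in
-- If any ball of the cluster rests, so does its lowest ball `α`; and rest differs from free fall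
-- only when time passes.
theorem free_of_not_rest {α β a b : ℕ} (hβ : β ≤ n)
    (h : ∀ k ∈ Ico a b, S.W k ≠ α ∧ S.W k ≠ β + 1)
    (hr : ∀ k ∈ Ico a b, ¬S.Rest k α ∨ S.t (k + 1) = S.t k) : S.Free α β a b := by
  refine fun k hk => ⟨(h k hk).1, (h k hk).2, fun j hj => ?_⟩
  obtain ⟨h1, h2⟩ := mem_Icc.1 hj
  rcases S.fall k j (h2.trans hβ) with h3 | ⟨h3, h4⟩
  · exact h3
  · rcases hr k hk with h5 | h5
    · exact absurd (fun i hi => h3 i (hi.trans h1)) h5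
    · rw [h4, (h3 j le_rfl).2, h5]; ring

/-- The number of collisions `w` in a stretch without floor collisions. -/
theorem exists_hits_le_noFloor {α β w : ℕ} (hβ : β ≤ n) (hw : w ∈ Ioc α β) (N : ℕ) :
    ∃ N', ∀ (S : BallSeq n m c) (a b : ℕ), a ≤ b →
      (∀ k ∈ Ico a b, S.W k ≠ α ∧ S.W k ≠ β + 1) →
      (∀ a' b', a ≤ a' → b' ≤ b → ∀ x ∈ Ioc α β, (∀ k ∈ Ico a' b', S.W k ≠ x) →
        S.hits w a' b' ≤ N) →
      S.hits w a b ≤ N' := by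
  obtain ⟨N₁, hN₁⟩ := exists_hits_le_free (c := c) hm hβ hw N
  have hw' := mem_Ioc.1 hw
  have hα : α ≤ n := by omega
  -- Four phases: free until ball `α` first rests at `k₀` (`N₁`); at rest, hence without collision
  -- `α + 1`, until `k₁` (`N`); the collision `k₁` itself (`1`); afterwards ball `α` is pressed to
  -- the floor, time stands still and the cluster is free again (`N₁`).
  refine ⟨2 * N₁ + N + 1, fun S a b hab hW h => ?_⟩
  have key : ∀ a' b', a ≤ a' → a' ≤ b' → b' ≤ b →
      (∀ k ∈ Ico a' b', ¬S.Rest k α ∨ S.t (k + 1) = S.t k) → S.hits w a' b' ≤ N₁ := by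
    intro a' b' h1 h2 h3 h4
    exact hN₁ S a' b' h2
      (S.free_of_not_rest hβ (fun k hk => hW k (Ico_subset_Ico h1 h3 hk)) h4)
      fun a'' b'' h5 h6 => h a'' b'' (h1.trans h5) (h6.trans h3)
  classical
  by_cases hr : ∃ k, k ∈ Ico a b ∧ S.Rest k α
  swap
  · push Not at hr
    have := key a b le_rfl hab le_rfl fun k hk => Or.inl (hr k hk)
    omega
  obtain ⟨hk₀, hrest⟩ := Nat.find_spec hr
  have hmin := fun k (hk : k < Nat.find hr) => Nat.find_min hr hk
  set k₀ := Nat.find hr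
  have hk₀' := mem_Ico.1 hk₀
  have h1 := key a k₀ le_rfl hk₀'.1 hk₀'.2.le fun k hk => Or.inl fun hR =>
    hmin k (mem_Ico.1 hk).2 ⟨mem_Ico.2 ⟨(mem_Ico.1 hk).1, (mem_Ico.1 hk).2.trans hk₀'.2⟩, hR⟩
  have h2 := S.hits_split w hk₀'.1 hk₀'.2.le
  by_cases hl : ∃ k, k ∈ Ico k₀ b ∧ S.W k = α + 1
  swap
  · push Not at hl
    have := h k₀ b hk₀'.1 le_rfl (α + 1) (mem_Ioc.2 (by omega)) hl
    omega
  obtain ⟨hk₁, hl₁⟩ := Nat.find_spec hl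
  have hmin₁ := fun k (hk : k < Nat.find hl) => Nat.find_min hl hk
  set k₁ := Nat.find hl
  have hk₁' := mem_Ico.1 hk₁
  have hno : ∀ k ∈ Ico k₀ k₁, S.W k ≠ α + 1 := fun k hk hW =>
    hmin₁ k (mem_Ico.1 hk).2 ⟨mem_Ico.2 ⟨(mem_Ico.1 hk).1, (mem_Ico.1 hk).2.trans hk₁'.2⟩, hW⟩
  have h3 := h k₀ k₁ hk₀'.1 hk₁'.2.le (α + 1) (mem_Ioc.2 (by omega)) hno
  have hrest₁ : ∀ k, k₀ ≤ k → k ≤ k₁ → S.Rest k α := by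
    intro k hk
    induction k, hk using Nat.le_induction with
    | base => exact fun _ => hrest
    | succ k hk ih => exact fun hk' =>
        (ih (by omega)).succ hm hα (hno k (mem_Ico.2 ⟨hk, hk'⟩))
  have hpress : ∀ k, k₁ + 1 ≤ k → k ≤ b → S.q k α = 0 ∧ S.v k α < 0 := by
    intro k hk
    induction k, hk using Nat.le_induction with
    | base => exact fun _ => (hrest₁ k₁ hk₁'.1 le_rfl).succ_of_hit hm hα hl₁
    | succ k hk ih =>
      intro hk'
      obtain ⟨h5, h6⟩ := ih (by omega)
      exact S.pressed_succ hm hα h5 h6 (hW k (mem_Ico.2 (by omega))).1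
  have h4 := key (k₁ + 1) b (by omega) hk₁'.2 le_rfl fun k hk => by
    have hk := mem_Ico.1 hk
    obtain ⟨h5, h6⟩ := hpress k hk.1 hk.2.le
    exact Or.inr (S.frozen k α hα h5 h6)
  have h5 := S.hits_split w hk₁'.1 hk₁'.2.le
  have h6 := S.hits_split w (Nat.le_succ k₁) hk₁'.2
  have h7 := S.hits_succ w k₁ k₁ le_rfl
  have h8 : S.hits w k₁ k₁ = 0 := by simp [hits]
  have h9 : S.hits w k₁ (k₁ + 1) ≤ 1 := by rw [h7, h8]; split_ifs <;> omega
  rw [Nat.succ_eq_add_one] at h6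
  omega

/-- The number of collisions `w` in a stretch of bounded length on which the energy of the balls
`0, …, w` is bounded below and only collisions between `l` and `r` occur. -/
theorem exists_hits_le_aux (hc : 0 ≤ c) {w : ℕ} (T : ℝ) {E : ℝ} (hE : 0 < E) :
    ∀ s l r : ℕ, r - l ≤ s → l ≤ w → w ≤ r → r ≤ n →
    ∃ N, ∀ (S : BallSeq n m c) (a b : ℕ), a ≤ b → S.t b - S.t a ≤ T →
      (∀ k ∈ Ico a b, E ≤ S.clusterEnergy k w) →
      (∀ k ∈ Ico a b, S.W k + 1 ≠ l ∧ S.W k ≠ r + 1) → S.hits w a b ≤ N := by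
  intro s
  induction s using Nat.strong_induction_on with
  | _ s ih =>
  intro l r hs hl hr hn
  -- A missing collision `x` cuts the window in two, and only the half containing `w` matters. The
  -- range conditions stand behind `∃ N` so that `choose` yields a function on all of `ℕ`.
  have hx : ∀ x : ℕ, ∃ N, l ≤ x → x ≤ r → ∀ (S : BallSeq n m c) (a b : ℕ), a ≤ b →
      S.t b - S.t a ≤ T → (∀ k ∈ Ico a b, E ≤ S.clusterEnergy k w) →
      (∀ k ∈ Ico a b, S.W k + 1 ≠ l ∧ S.W k ≠ r + 1) → (∀ k ∈ Ico a b, S.W k ≠ x) →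
      S.hits w a b ≤ N := by
    intro x
    by_cases hx : l ≤ x ∧ x ≤ r
    swap
    · exact ⟨0, fun h1 h2 => absurd ⟨h1, h2⟩ hx⟩
    obtain ⟨hx1, hx2⟩ := hx
    rcases lt_trichotomy x w with h | rfl | h
    · obtain ⟨N, hN⟩ := ih (r - (x + 1)) (by omega) (x + 1) r le_rfl h hr hn
      exact ⟨N, fun _ _ S a b hab hT hE' hW hWx => hN S a b hab hT hE' fun k hk =>
        ⟨by have := hWx k hk; omega, (hW k hk).2⟩⟩
    · exact ⟨0, fun _ _ S a b _ _ _ _ hWx => (S.hits_eq_zero hWx).le⟩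
    · obtain ⟨N, hN⟩ := ih (x - 1 - l) (by omega) l (x - 1) le_rfl hl (by omega) (by omega)
      exact ⟨N, fun _ _ S a b hab hT hE' hW hWx => hN S a b hab hT hE' fun k hk =>
        ⟨(hW k hk).1, by have := hWx k hk; omega⟩⟩
  choose Nx hNx using hx
  have hmiss : ∀ (S : BallSeq n m c) (a b : ℕ), S.t b - S.t a ≤ T →
      (∀ k ∈ Ico a b, E ≤ S.clusterEnergy k w) →
      (∀ k ∈ Ico a b, S.W k + 1 ≠ l ∧ S.W k ≠ r + 1) → ∀ a' b', a ≤ a' → b' ≤ b →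
      ∀ x, l ≤ x → x ≤ r → (∀ k ∈ Ico a' b', S.W k ≠ x) →
      S.hits w a' b' ≤ ∑ x ∈ Icc l r, Nx x := by
    intro S a b hT hE' hW a' b' ha hb x hx1 hx2 hWx
    rcases le_total a' b' with hab' | hab'
    · have hsub := Ico_subset_Ico ha hb
      have h1 := hNx x hx1 hx2 S a' b' hab'
        (by linarith [S.t_mono ha, S.t_mono hb]) (fun k hk => hE' k (hsub hk))
        (fun k hk => hW k (hsub hk)) hWx
      exact h1.trans (single_le_sum (f := Nx) (fun _ _ => Nat.zero_le _) (mem_Icc.2 ⟨hx1, hx2⟩))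
    · simp [hits, Ico_eq_empty_of_le hab']
  -- The condition `S.W k + 1 ≠ l` is vacuous for `l = 0`, where the floor belongs to the window;
  -- otherwise ball `l - 1` is the lowest of a cluster that is not hit from outside.
  rcases Nat.eq_zero_or_pos l with rfl | hl0
  · obtain ⟨N, hN⟩ := exists_hits_le_floor hm hc hn hr hE (T := T) (∑ x ∈ Icc 0 r, Nx x)
    exact ⟨N, fun S a b hab hT hE' hW => hN S a b hab hT hE' fun a' b' ha hb x hx =>
      hmiss S a b hT hE' hW a' b' ha hb x (Nat.zero_le x) hx⟩
  · obtain ⟨N, hN⟩ := exists_hits_le_noFloor (c := c) hm hn (α := l - 1) (w := w)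
      (mem_Ioc.2 (by omega)) (∑ x ∈ Icc l r, Nx x)
    refine ⟨N, fun S a b hab hT hE' hW => hN S a b hab (fun k hk => ?_) fun a' b' ha hb x hx =>
      hmiss S a b hT hE' hW a' b' ha hb x ?_ (mem_Ioc.1 hx).2⟩
    · have := hW k hk
      omega
    · have := mem_Ioc.1 hx
      omega

theorem exists_hits_le (hc : 0 ≤ c) {w : ℕ} (hw : w ≤ n) (T : ℝ) {E : ℝ} (hE : 0 < E) :
    ∃ N, ∀ (S : BallSeq n m c) (a b : ℕ), a ≤ b → S.t b - S.t a ≤ T →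
      (∀ k ∈ Ico a b, E ≤ S.clusterEnergy k w) → S.hits w a b ≤ N := by
  obtain ⟨N, hN⟩ := exists_hits_le_aux hm hc (w := w) T hE n 0 n (by omega) (Nat.zero_le w) hw le_rfl
  exact ⟨N, fun S a b hab hT hE' => hN S a b hab hT hE' fun k _ =>
    ⟨by omega, by have := S.W_le k; omega⟩⟩

omit hm in
theorem exists_le_hits {w a : ℕ} (h : ∀ a', ∃ k ≥ a', S.W k = w) :
    ∀ M, ∃ b, a ≤ b ∧ M ≤ S.hits w a b := by
  intro M
  induction M with
  | zero => exact ⟨a, le_rfl, Nat.zero_le _⟩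
  | succ M ih =>
    obtain ⟨b, h1, h2⟩ := ih
    obtain ⟨k, h3, h4⟩ := h b
    refine ⟨k + 1, by omega, ?_⟩
    rw [S.hits_succ w a k (by omega), if_pos h4, S.hits_split w h1 h3]
    omega

/-- Collision times do not accumulate. -/
theorem tendsto_t (hc : 0 ≤ c) : Filter.Tendsto S.t Filter.atTop Filter.atTop := by
  refine Filter.tendsto_atTop_atTop_of_monotone S.t_mono fun T => ?_
  by_contra! hT
  -- The collisions die out from the top. Once those above `w = n - j` have ceased, the energy of
  -- the balls `0, …, w` is constant. It is positive, since resting balls would need a collision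
  -- above `w`; so the count makes the collisions `w` finite in number. At `j = n + 1` nothing is
  -- left.
  have key : ∀ j ≤ n + 1, ∃ a, ∀ k ≥ a, S.W k + j ≤ n := by
    intro j
    induction j with
    | zero => exact fun _ => ⟨0, fun k _ => S.W_le k⟩
    | succ j ih =>
      intro hj
      obtain ⟨a, ha⟩ := ih (by omega)
      set w := n - j
      have hw : w ≤ n := Nat.sub_le n j
      have hconst : ∀ k ≥ a, S.clusterEnergy k w = S.clusterEnergy a w := by
        intro k hk
        induction k, hk using Nat.le_induction with
        | base => rfl
        | succ k hk ih =>
          rw [S.clusterEnergy_succ hm hw (by have := ha k hk; omega), ih]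
      have hE : 0 < S.clusterEnergy a w := by
        by_contra! hE
        have hR : S.Rest a w := by
          intro i hi
          have h1 := (S.ball_le_clusterEnergy hm (k := a) (hi.trans hw)).trans
            ((S.clusterEnergy_mono hm hi hw).trans hE)
          have h2 := S.q_nonneg a i (hi.trans hw)
          have h3 := nonpos_of_mul_nonpos_right h1 (hm i)
          have h4 := sq_nonneg (S.v a i)
          exact ⟨by linarith, pow_eq_zero_iff two_ne_zero |>.1 (by linarith)⟩
        have h1 := hR.lt_W hw hm
        have h2 := ha a le_rfl
        omega
      obtain ⟨N, hN⟩ := exists_hits_le hm hc hw (T - S.t a) hE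
      by_contra! hinf
      obtain ⟨b, h1, h2⟩ := S.exists_le_hits (w := w) (a := a) (fun a' => by
        obtain ⟨k, h3, h4⟩ := hinf (max a a')
        have h5 := ha k (le_of_max_le_left h3)
        exact ⟨k, le_of_max_le_right h3, by omega⟩) (N + 1)
      have h3 := hN S a b h1 (by linarith [hT b])
        fun k hk => (hconst k (mem_Ico.1 hk).1).ge
      omega
  obtain ⟨a, ha⟩ := key (n + 1) le_rfl
  have := ha a le_rfl
  omega

end masses

end BallSeq
end FallingBalls

namespace FallingBalls

open Finset
namespace BallSeq

variable {n : ℕ} {m : ℕ → ℝ} {c : ℝ} (S : BallSeq n m c)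

/-! ### Strong collisions -/

/-- The momentum transferred by the collisions `w` with index in `[a, b)`. -/
noncomputable def impulse (w a b : ℕ) : ℝ := ∑ k ∈ Ico a b, if S.W k = w then S.J k else 0

theorem impulse_succ {w a b : ℕ} (hab : a ≤ b) :
    S.impulse w a (b + 1) = S.impulse w a b + if S.W b = w then S.J b else 0 :=
  sum_Ico_succ_top hab _

theorem impulse_le {w a b : ℕ} {C : ℝ} (h : ∀ k ∈ Ico a b, S.W k = w → S.J k ≤ C) :
    S.impulse w a b ≤ S.hits w a b * C := by
  rw [impulse, ← sum_filter, hits, ← nsmul_eq_mul]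
  exact sum_le_card_nsmul _ _ _ fun k hk => h k (mem_filter.1 hk).1 (mem_filter.1 hk).2

section masses
variable (hm : ∀ j, 0 < m j)
include hm

theorem v_le_add_impulse {w a b : ℕ} (hw : w ≤ n) (hab : a ≤ b) :
    m w * S.v b w ≤ m w * S.v a w + S.impulse w a b := by
  induction b, hab using Nat.le_induction with
  | base => simp [impulse]
  | succ b hab ih =>
    rw [S.impulse_succ hab, S.hit b w hw]
    have h1 := mul_le_mul_of_nonneg_left (S.u_le_v (k := b) hw) (hm w).le
    have h2 : 0 ≤ if S.W b = w + 1 then S.J b else 0 := by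
      split_ifs
      exacts [(S.J_pos b).le, le_rfl]
    linarith

omit hm in
theorem v_top_eq (hc : 0 < c) {a b : ℕ} (hab : a ≤ b) :
    m n * S.v b n = m n * S.v a n - m n * (S.t b - S.t a) + S.impulse n a b := by
  induction b, hab using Nat.le_induction with
  | base => simp [impulse]
  | succ b hab ih =>
    have := S.W_le b
    rw [S.impulse_succ hab, S.hit b n le_rfl, S.u_top hc, if_neg (by omega : ¬S.W b = n + 1)]
    linarith

theorem exists_t_ge (hc : 0 < c) (a : ℕ) {T : ℝ} (hT : 0 < T) :
    ∃ b, a ≤ b ∧ T ≤ S.t b - S.t a ∧ S.t b - S.t a ≤ T + 2 * bound n m c := by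
  have hex := ((S.tendsto_t hm hc.le).eventually_ge_atTop (S.t a + T)).exists
  classical
  have h1 := Nat.find_spec hex
  have hmin := fun k (hk : k < Nat.find hex) => Nat.find_min hex hk
  set b := Nat.find hex
  have hab : a < b := by
    by_contra! h
    linarith [S.t_mono h]
  obtain ⟨b', hb'⟩ : ∃ b', b = b' + 1 := ⟨b - 1, by omega⟩
  have h2 := hmin b' (by omega)
  have h3 := S.t_succ_le hm hc b'
  rw [← hb'] at h3
  exact ⟨b, hab.le, by linarith, by linarith⟩

theorem exists_t_le (hc : 0 < c) {a k : ℕ} {T : ℝ} (hT : 0 < T) (hk : S.t a + T ≤ S.t k) :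
    ∃ j, a ≤ j ∧ j ≤ k ∧ T ≤ S.t k - S.t j ∧ S.t k - S.t j ≤ T + 2 * bound n m c := by
  have hex : ∃ j, S.t k - T < S.t j := ⟨k, by linarith⟩
  classical
  have h1 := Nat.find_spec hex
  have hmin := fun j (hj : j < Nat.find hex) => Nat.find_min hex hj
  have hle : Nat.find hex ≤ k := Nat.find_min' hex (by linarith)
  set j := Nat.find hex
  have haj : a < j := by
    by_contra! h
    linarith [S.t_mono h]
  obtain ⟨j', hj'⟩ : ∃ j', j = j' + 1 := ⟨j - 1, by omega⟩
  have h2 := hmin j' (by omega)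
  have h3 := S.t_succ_le hm hc j'
  rw [← hj'] at h3
  exact ⟨j', by omega, by omega, by linarith, by linarith⟩

/-- During a time `2 * V + 1` gravity takes more velocity than the interval `[-V, V]` allows, so
collisions `n` must return momentum at least `m n`; at most `N` of them share it. -/
theorem exists_strong_top (hc : 0 < c) :
    ∃ C > 0, ∀ (S : BallSeq n m c) (a : ℕ), ∃ k ≥ a, S.W k = n ∧ C ≤ S.J k := by
  have hV := one_le_bound (n := n) hm hc.le
  set V := bound n m c
  obtain ⟨N, hN⟩ := exists_hits_le hm hc.le (le_refl n) (2 * V + 1 + 2 * V) hc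
  have hmn := hm n
  refine ⟨m n / (N + 1), by positivity, fun S a => ?_⟩
  by_contra! h
  obtain ⟨b, hab, h1, h2⟩ := S.exists_t_ge hm hc a (T := 2 * V + 1) (by linarith)
  have h3 := hN S a b hab h2 fun k _ => (S.energy_eq k).ge
  have h4 := S.impulse_le (w := n) (a := a) (b := b) (C := m n / (N + 1))
    fun k hk hW => (h k (mem_Ico.1 hk).1 hW).le
  have h5 := S.v_top_eq hc hab
  have h6 := abs_le.1 (S.abs_v_le hm hc.le (k := a) (le_refl n))
  have h7 := abs_le.1 (S.abs_v_le hm hc.le (k := b) (le_refl n))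
  have h8 : (S.hits n a b : ℝ) * (m n / (N + 1)) < m n := by
    have : (S.hits n a b : ℝ) ≤ N := by exact_mod_cast h3
    calc (S.hits n a b : ℝ) * (m n / (N + 1)) ≤ N * (m n / (N + 1)) := by gcongr
      _ < m n := by rw [mul_div_assoc', div_lt_iff₀ (by positivity)]; nlinarith
  have h9 : m n * 1 ≤ m n * (S.t b - S.t a + S.v b n - S.v a n) := by
    gcongr
    linarith
  linarith

/-- A ball with a definite downward velocity is soon stopped by a strong collision from below. -/
theorem exists_strong_of_down (hc : 0 < c) {w : ℕ} (hw : w ≤ n) {h : ℝ} (hh : 0 < h) :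
    ∃ C > 0, ∀ (S : BallSeq n m c) (a : ℕ), S.v a w ≤ -h → ∃ k ≥ a, S.W k = w ∧ C ≤ S.J k := by
  have hV := one_le_bound (n := n) hm hc.le
  set V := bound n m c with hVdef
  have hmw := hm w
  obtain ⟨N, hN⟩ := exists_hits_le hm hc.le hw (4 * V / h + 1 + 2 * V)
    (show 0 < m w * ((h / 2) ^ 2 / 2) by positivity)
  refine ⟨m w * (h / 2) / (N + 1), by positivity, fun S a ha => ?_⟩
  by_contra! hno
  obtain ⟨b, hab, h1, h2⟩ := S.exists_t_ge hm hc a (T := 4 * V / h + 1) (by positivity)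
  -- Bootstrap: as long as the speed is at least `h / 2`, the ball alone supplies the energy needed
  -- for the count, and then the weak impulses together cannot reduce the speed below `h / 2`.
  have hv : ∀ j, a ≤ j → j ≤ b → S.v j w ≤ -(h / 2) := by
    intro j
    induction j using Nat.strong_induction_on with
    | _ j ih =>
    intro haj hjb
    have h3 := hN S a j haj (by linarith [S.t_mono hjb]) fun k hk => by
      obtain ⟨h4, h5⟩ := mem_Ico.1 hk
      have h6 := ih k h5 h4 (by omega)
      refine le_trans ?_ (S.ball_le_clusterEnergy hm hw)
      have := S.q_nonneg k w hw
      gcongr m w * ?_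
      nlinarith
    have h4 := S.impulse_le (w := w) (a := a) (b := j) (C := m w * (h / 2) / (N + 1))
      fun k hk hW => (hno k (mem_Ico.1 hk).1 hW).le
    have h5 : (S.hits w a j : ℝ) * (m w * (h / 2) / (N + 1)) ≤ m w * (h / 2) := by
      rw [mul_div_assoc', div_le_iff₀ (by positivity), mul_comm]
      gcongr
      have : (S.hits w a j : ℝ) ≤ N := by exact_mod_cast h3
      linarith
    have h6 := S.v_le_add_impulse hm hw haj
    refine le_of_mul_le_mul_left ?_ hmw
    have h7 := mul_le_mul_of_nonneg_left ha hmw.le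
    linarith
  have hq : ∀ j, a ≤ j → j ≤ b → S.q j w ≤ S.q a w - h / 2 * (S.t j - S.t a) := by
    intro j haj
    induction j, haj using Nat.le_induction with
    | base => intro _; simp
    | succ j haj ih =>
      intro hjb
      have h3 := ih (by omega)
      have h4 := hv j haj (by omega)
      have h5 := S.u_le_v (k := j) hw
      have h6 := S.t_le j
      rw [S.move j w hw]
      nlinarith
  have h3 := hq b hab le_rfl
  have h4 := S.q_le hm hc.le (k := a) hw
  have h5 := S.q_nonneg b w hw
  have h6 := mul_le_mul_of_nonneg_left h1 (show 0 ≤ h / 2 by positivity)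
  have h7 : h / 2 * (4 * V / h + 1) = 2 * V + h / 2 := by field_simp; ring
  linarith

/-- A ball with a definite upward velocity recently suffered a strong collision from below. -/
theorem exists_strong_of_up (hc : 0 < c) {w : ℕ} (hw : w ≤ n) {h : ℝ} (hh : 0 < h) :
    ∃ C > 0, ∃ T, ∀ (S : BallSeq n m c) (a k : ℕ), S.t a + T ≤ S.t k → h ≤ S.v k w →
      ∃ k ≥ a, S.W k = w ∧ C ≤ S.J k := by
  have hV := one_le_bound (n := n) hm hc.le
  set V := bound n m c with hVdef
  have hmw := hm w
  obtain ⟨N, hN⟩ := exists_hits_le hm hc.le hw (4 * V / h + 1 + 2 * V)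
    (show 0 < m w * ((h / 2) ^ 2 / 2) by positivity)
  refine ⟨m w * (h / 4) / (N + 1), by positivity, 4 * V / h + 1, fun S a k hak hk => ?_⟩
  by_contra! hno
  have hC : m w * (h / 4) / (N + 1) ≤ m w * (h / 4) :=
    div_le_self (by positivity) (by linarith [Nat.cast_nonneg (α := ℝ) N])
  obtain ⟨i, hai, hik, h1, h2⟩ := S.exists_t_le hm hc (T := 4 * V / h + 1) (by positivity) hak
  -- The same bootstrap backward in time from `k`; gravity helps, since the ball was faster earlier.
  have hv : ∀ s j, i ≤ j → j ≤ k → k - j ≤ s → h / 2 ≤ S.v j w := by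
    intro s
    induction s with
    | zero =>
      intro j _ h3 h4
      obtain rfl : j = k := by omega
      linarith
    | succ s ih =>
      intro j hij hjk hs
      rcases hjk.eq_or_lt with rfl | hlt
      · linarith
      have h3 := hN S (j + 1) k hlt
        (by linarith [S.t_mono (hij.trans (Nat.le_succ j))]) fun l hl => by
          obtain ⟨h4, h5⟩ := mem_Ico.1 hl
          have h6 := ih l (by omega) h5.le (by omega)
          refine le_trans ?_ (S.ball_le_clusterEnergy hm hw)
          have := S.q_nonneg l w hw
          gcongr m w * ?_
          nlinarith
      have h4 := S.impulse_le (w := w) (a := j) (b := k) (C := m w * (h / 4) / (N + 1))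
        fun l hl hW => (hno l (by have := mem_Ico.1 hl; omega) hW).le
      -- The energy bound is known only from `j + 1` on, so collision `j` is counted separately.
      have h5 : S.hits w j k ≤ N + 1 := by
        have h6 := S.hits_succ w j j le_rfl
        have h7 := S.hits_split w (Nat.le_succ j) hlt
        have h8 : S.hits w j j = 0 := by simp [hits]
        rw [Nat.succ_eq_add_one] at h7
        split_ifs at h6 <;> omega
      have h6 : (S.hits w j k : ℝ) * (m w * (h / 4) / (N + 1)) ≤ m w * (h / 4) := by
        rw [mul_div_assoc', div_le_iff₀ (by positivity), mul_comm]
        gcongr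
        exact_mod_cast h5
      have h7 := S.v_le_add_impulse hm hw hlt.le
      refine le_of_mul_le_mul_left ?_ hmw
      have h8 := mul_le_mul_of_nonneg_left hk hmw.le
      have h9 : 0 < m w * h := by positivity
      linarith
  have hq : ∀ j, i ≤ j → j ≤ k → S.q i w + h / 4 * (S.t j - S.t i) ≤ S.q j w := by
    intro j hij
    induction j, hij using Nat.le_induction with
    | base => intro _; simp
    | succ j hij ih =>
      intro hjk
      have h3 := ih (by omega)
      have h4 := hv (k - j) j hij (by omega) le_rfl
      have h5 := hv (k - (j + 1)) (j + 1) (by omega) hjk le_rfl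
      have h6 := S.hit j w hw
      -- Heights depend on `u j` as well; it differs from `v (j + 1)` by at most one weak impulse
      -- from below, as a hit from above only lowers the velocity.
      have h7 : h / 4 ≤ S.u j w := by
        refine le_of_mul_le_mul_left ?_ hmw
        have h8 := mul_le_mul_of_nonneg_left h5 hmw.le
        have h9 : (if S.W j = w then S.J j else 0) ≤ m w * (h / 4) := by
          split_ifs with hW
          · exact (hno j (by omega) hW).le.trans hC
          · positivity
        have h10 : 0 ≤ if S.W j = w + 1 then S.J j else 0 := by
          split_ifs
          exacts [(S.J_pos j).le, le_rfl]
        linarith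
      have h8 := S.t_le j
      rw [S.move j w hw]
      nlinarith
  have h3 := hq k hik le_rfl
  have h4 := S.q_le hm hc.le (k := k) hw
  have h5 := S.q_nonneg i w hw
  have h6 := mul_le_mul_of_nonneg_left h1 (show 0 ≤ h / 4 by positivity)
  have h7 : h / 4 * (4 * V / h + 1) = V + h / 4 := by field_simp
  linarith

theorem exists_strong_step (hc : 0 < c) {w : ℕ} (hw : w + 1 ≤ n)
    (h : ∃ C > 0, ∀ (S : BallSeq n m c) (a : ℕ), ∃ k ≥ a, S.W k = w + 1 ∧ C ≤ S.J k) :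
    ∃ C > 0, ∀ (S : BallSeq n m c) (a : ℕ), ∃ k ≥ a, S.W k = w ∧ C ≤ S.J k := by
  obtain ⟨C, hC, h⟩ := h
  have hmw := hm w
  have hwn : w ≤ n := by omega
  have hh : 0 < C / (2 * m w) := by positivity
  obtain ⟨C₁, hC₁, h₁⟩ := exists_strong_of_down hm hc hwn hh
  obtain ⟨C₂, hC₂, T, h₂⟩ := exists_strong_of_up hm hc hwn hh
  refine ⟨min C₁ C₂, lt_min hC₁ hC₂, fun S a => ?_⟩
  obtain ⟨a', ha'⟩ := ((S.tendsto_t hm hc.le).eventually_ge_atTop (S.t a + T)).exists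
  -- Starting after `a'` leaves a past of length `T` in which a strong collision still has index at
  -- least `a`.
  obtain ⟨k, hk, hW, hJ⟩ := h S (max a a')
  have hit := S.hit k w hwn
  rw [if_neg (by omega), if_pos hW] at hit
  by_cases hv : S.v (k + 1) w ≤ -(C / (2 * m w))
  · obtain ⟨k', h3, h4, h5⟩ := h₁ S (k + 1) hv
    exact ⟨k', by omega, h4, (min_le_left _ _).trans h5⟩
  · have h3 : C / (2 * m w) ≤ S.u k w := by
      push Not at hv
      refine le_of_mul_le_mul_left ?_ hmw
      have h4 := mul_lt_mul_of_pos_left hv hmw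
      have h5 : m w * (C / (2 * m w)) = C / 2 := by field_simp
      rw [mul_neg] at h4
      linarith
    obtain ⟨k', h4, h5, h6⟩ := h₂ S a k (ha'.trans (S.t_mono (le_of_max_le_right hk)))
      (h3.trans (S.u_le_v hwn))
    exact ⟨k', h4, h5, (min_le_right _ _).trans h6⟩

/-- Strong collisions of each kind recur, with a uniform bound. -/
theorem exists_strong (hc : 0 < c) {w : ℕ} (hw : w ≤ n) :
    ∃ C > 0, ∀ (S : BallSeq n m c) (a : ℕ), ∃ k ≥ a, S.W k = w ∧ C ≤ S.J k := by
  induction hw using Nat.decreasingInduction with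
  | self => exact exists_strong_top hm hc
  | of_succ _ hw ih => exact exists_strong_step hm hc hw ih

end masses

end BallSeq
end FallingBalls

namespace FallingBalls

open Filter Topology

variable {n : ℕ}

/-! ### Existence of orbits -/

instance : Finite (Collision n) :=
  Finite.of_surjective (fun o : Option (Fin n) => o.elim Collision.floor Collision.pair) fun κ => by
    cases κ with
    | floor => exact ⟨none, rfl⟩
    | pair i => exact ⟨some i, rfl⟩

/-- The distance that vanishes at the collision `κ`. -/
def gap (κ : Collision n) (x : Phase n) : ℝ :=
  match κ with
  | .floor => x.q 0
  | .pair i => x.q i.succ - x.q i.castSucc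

/-- The rate of change of `gap κ`. -/
noncomputable def slope (m : Fin (n + 1) → ℝ) (κ : Collision n) (x : Phase n) : ℝ :=
  match κ with
  | .floor => vel m x 0
  | .pair i => vel m x i.succ - vel m x i.castSucc

open Classical in
/-- The deceleration of `gap κ`, which is `1` if exactly one of its two ends is at rest. -/
noncomputable def decel (κ : Collision n) (x : Phase n) : ℝ :=
  match κ with
  | .floor => if Resting x 0 then 0 else 1
  | .pair i => if Resting x i.castSucc ∧ ¬Resting x i.succ then 1 else 0

theorem Resting.mono {x : Phase n} {i j : Fin (n + 1)} (h : Resting x j) (hij : i ≤ j) :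
    Resting x i := fun k hk => h k (hk.trans hij)

theorem Resting.vel_eq {x : Phase n} {j : Fin (n + 1)} (h : Resting x j) (m : Fin (n + 1) → ℝ) :
    vel m x j = 0 := by rw [vel, (h j le_rfl).2, zero_div]

theorem mem_energySurface_iff {m : Fin (n + 1) → ℝ} {c : ℝ} {x : Phase n} :
    x ∈ energySurface m c ↔ (∀ κ, 0 ≤ gap κ x) ∧ energy m x = c := by
  unfold energySurface
  rw [Set.mem_ofPred_eq, ← and_assoc]
  refine and_congr_left fun _ => ⟨fun h κ => ?_, fun h => ⟨h .floor, ?_⟩⟩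
  · cases κ with
    | floor => exact h.1
    | pair i => exact sub_nonneg.2 (h.2 i.castSucc_le_succ)
  · exact Fin.monotone_iff_le_succ.2 fun i => sub_nonneg.1 (h (.pair i))

theorem mem_preCollision_iff {m : Fin (n + 1) → ℝ} {c : ℝ} {x : Phase n} {κ : Collision n} :
    x ∈ preCollision m c κ ↔ x ∈ energySurface m c ∧ gap κ x = 0 ∧ slope m κ x < 0 := by
  cases κ with
  | floor => rfl
  | pair i =>
    simp only [preCollision, Set.mem_ofPred_eq, gap, slope, sub_neg, sub_eq_zero]
    rw [eq_comm (a := x.q i.castSucc)]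

theorem vel_flow {m : Fin (n + 1) → ℝ} (hm : ∀ i, 0 < m i) (t : ℝ) (x : Phase n)
    (j : Fin (n + 1)) :
    (Resting x j ∧ vel m (flow m t x) j = 0) ∨
      (¬Resting x j ∧ vel m (flow m t x) j = vel m x j - t) := by
  by_cases h : Resting x j
  · left; simp [h, vel, flow]
  · right
    have := (hm j).ne'
    simp only [h, vel, flow, if_false, not_false_iff, true_and]
    field_simp

theorem q_flow (m : Fin (n + 1) → ℝ) (t : ℝ) (x : Phase n) (j : Fin (n + 1)) :
    (Resting x j ∧ (flow m t x).q j = 0) ∨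
      (¬Resting x j ∧ (flow m t x).q j = x.q j + t * vel m x j - t ^ 2 / 2) := by
  by_cases h : Resting x j
  · left; simp [h, flow]
  · right; simp [h, flow]

theorem gap_flow (m : Fin (n + 1) → ℝ) (t : ℝ) (x : Phase n) (κ : Collision n) :
    gap κ (flow m t x) = gap κ x + t * slope m κ x - decel κ x * (t ^ 2 / 2) := by
  cases κ with
  | floor =>
    simp only [gap, slope, decel]
    rcases q_flow m t x 0 with ⟨h, h'⟩ | ⟨h, h'⟩
    · rw [h', h.vel_eq, (h 0 le_rfl).1, if_pos h]; ring
    · rw [h', if_neg h]; ring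
  | pair i =>
    simp only [gap, slope, decel]
    rcases q_flow m t x i.succ with ⟨h, h'⟩ | ⟨h, h'⟩ <;>
      rcases q_flow m t x i.castSucc with ⟨g, g'⟩ | ⟨g, g'⟩
    · rw [h', g', h.vel_eq, g.vel_eq, (h _ le_rfl).1, (g _ le_rfl).1, if_neg (by tauto)]; ring
    · exact absurd (h.mono i.castSucc_le_succ) g
    · rw [h', g', g.vel_eq, (g _ le_rfl).1, if_pos ⟨g, h⟩]; ring
    · rw [h', g', if_neg (by tauto)]; ring

theorem slope_flow {m : Fin (n + 1) → ℝ} (hm : ∀ i, 0 < m i) (t : ℝ) (x : Phase n)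
    (κ : Collision n) : slope m κ (flow m t x) = slope m κ x - decel κ x * t := by
  cases κ with
  | floor =>
    simp only [slope, decel]
    rcases vel_flow hm t x 0 with ⟨h, h'⟩ | ⟨h, h'⟩
    · rw [h', h.vel_eq, if_pos h]; ring
    · rw [h', if_neg h]; ring
  | pair i =>
    simp only [slope, decel]
    rcases vel_flow hm t x i.succ with ⟨h, h'⟩ | ⟨h, h'⟩ <;>
      rcases vel_flow hm t x i.castSucc with ⟨g, g'⟩ | ⟨g, g'⟩
    · rw [h', g', h.vel_eq, g.vel_eq, if_neg (by tauto)]; ring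
    · exact absurd (h.mono i.castSucc_le_succ) g
    · rw [h', g', g.vel_eq, if_pos ⟨g, h⟩]; ring
    · rw [h', g', if_neg (by tauto)]; ring

/-- A ball that touches a resting one with the same velocity rests as well. -/
theorem decel_eq_zero {m : Fin (n + 1) → ℝ} (hm : ∀ i, 0 < m i) {x : Phase n} {κ : Collision n}
    (hg : gap κ x = 0) (hs : slope m κ x = 0) : decel κ x = 0 := by
  cases κ with
  | floor =>
    simp only [gap, slope, decel, vel] at *
    rw [if_pos]
    intro k hk
    obtain rfl : k = 0 := le_antisymm hk (Fin.zero_le k)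
    exact ⟨hg, (div_eq_zero_iff.1 hs).resolve_right (hm _).ne'⟩
  | pair i =>
    simp only [gap, slope, decel] at *
    rw [if_neg]
    rintro ⟨h1, h2⟩
    apply h2
    intro k hk
    rcases hk.eq_or_lt with rfl | hlt
    · rw [h1.vel_eq, sub_zero, vel] at hs
      rw [(h1 _ le_rfl).1, sub_zero] at hg
      exact ⟨hg, (div_eq_zero_iff.1 hs).resolve_right (hm _).ne'⟩
    · exact h1 k (Fin.le_castSucc_iff.2 hlt)

theorem decel_eq (κ : Collision n) (x : Phase n) : decel κ x = 0 ∨ decel κ x = 1 := by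
  cases κ <;> simp only [decel] <;> split_ifs <;> simp

theorem energy_flow {m : Fin (n + 1) → ℝ} (hm : ∀ i, 0 < m i) (t : ℝ) (x : Phase n) :
    energy m (flow m t x) = energy m x := by
  refine Finset.sum_congr rfl fun j _ => ?_
  by_cases h : Resting x j
  · simp [flow, h, h j le_rfl]
  · have := (hm j).ne'
    simp only [flow, h, vel, if_false]
    field_simp
    ring

theorem not_resting_last {m : Fin (n + 1) → ℝ} {c : ℝ} (hc : 0 < c) {x : Phase n}
    (hx : x ∈ energySurface m c) : ¬Resting x (Fin.last n) := by
  intro h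
  have h1 : energy m x = c := hx.2.2
  rw [energy, Finset.sum_eq_zero fun j _ => by simp [h j (Fin.le_last j)]] at h1
  exact hc.ne h1

/-- Every flow line of positive energy reaches a collision. -/
theorem exists_isReturnTime {m : Fin (n + 1) → ℝ} (hm : ∀ i, 0 < m i) {c : ℝ} (hc : 0 < c)
    {x : Phase n} (hx : x ∈ energySurface m c) :
    ∃ τ κ, IsReturnTime m c x τ ∧ flow m τ x ∈ preCollision m c κ := by
  have hx' := mem_energySurface_iff.1 hx
  have hmem : ∀ t, flow m t x ∈ energySurface m c ↔ ∀ κ, 0 ≤ gap κ (flow m t x) := fun t => by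
    rw [mem_energySurface_iff, energy_flow hm, hx'.2]
    simp
  set A : Set ℝ := {t | 0 ≤ t ∧ flow m t x ∈ energySurface m c} with hA
  have hcont : ∀ κ, Continuous fun t => gap κ (flow m t x) := fun κ => by
    simp only [gap_flow]
    fun_prop
  have hclosed : IsClosed A := by
    have : A = Set.Ici 0 ∩ ⋂ κ, {t | 0 ≤ gap κ (flow m t x)} := by
      ext t; simp [hA, hmem]
    rw [this]
    exact isClosed_Ici.inter (isClosed_iInter fun κ => isClosed_le continuous_const (hcont κ))
  have h0 : (0 : ℝ) ∈ A := ⟨le_rfl, (hmem 0).2 fun κ => by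
    rw [gap_flow]; simpa using hx'.1 κ⟩
  have hbdd : BddAbove A := by
    refine ⟨2 * (|vel m x (Fin.last n)| + x.q (Fin.last n) + 1), fun t ht => ?_⟩
    have h1 : 0 ≤ (flow m t x).q (Fin.last n) := ht.2.1.trans (ht.2.2.1 (Fin.zero_le _))
    rcases q_flow m t x (Fin.last n) with ⟨h, -⟩ | ⟨-, h⟩
    · exact absurd h (not_resting_last hc hx)
    · rw [h] at h1
      have h2 : 0 ≤ x.q (Fin.last n) := hx.1.trans (hx.2.1 (Fin.zero_le _))
      have h3 := le_abs_self (vel m x (Fin.last n))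
      have h4 := abs_nonneg (vel m x (Fin.last n))
      by_contra! h5
      nlinarith [ht.1]
  set τ := sSup A with hτ
  have hτA : τ ∈ A := hclosed.csSup_mem ⟨0, h0⟩ hbdd
  -- Each gap is a polynomial of degree at most two in time, expanded here about an arbitrary `t`;
  -- `decel κ x` belongs to the initial state and does not change along the flow line.
  have hexp : ∀ κ t s, gap κ (flow m s x) = gap κ (flow m t x) +
      (s - t) * slope m κ (flow m t x) - decel κ x * ((s - t) ^ 2 / 2) := by
    intro κ t s
    rw [gap_flow, gap_flow, slope_flow hm]
    ring
  -- Otherwise every gap stays nonnegative just after `τ`, against maximality. The delicate case is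
  -- zero gap and zero slope with deceleration `1`: looking back to time `0` forces `τ = 0`, and
  -- then `decel_eq_zero` excludes it.
  obtain ⟨κ, hκ⟩ : ∃ κ, gap κ (flow m τ x) = 0 ∧ slope m κ (flow m τ x) < 0 := by
    by_contra! hno
    have hev : ∀ κ, ∀ᶠ t in 𝓝[>] τ, 0 ≤ gap κ (flow m t x) := by
      intro κ
      have hg := (hmem τ).1 hτA.2 κ
      rcases hg.eq_or_lt with hg | hg
      · have hs := hno κ hg.symm
        rcases decel_eq κ x with ha | ha
        · filter_upwards [self_mem_nhdsWithin] with t ht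
          rw [hexp κ τ t, ← hg, ha]
          have : 0 ≤ t - τ := sub_nonneg.2 (le_of_lt ht)
          nlinarith
        · rcases hs.eq_or_lt with hs | hs
          · exfalso
            have h1 := hexp κ τ 0
            rw [← hg, ← hs, ha] at h1
            have h2 := (hmem 0).1 h0.2 κ
            have h3 : τ = 0 := pow_eq_zero_iff two_ne_zero |>.1 (by nlinarith [sq_nonneg τ])
            have h4 : gap κ x = 0 := by
              have := gap_flow m 0 x κ
              rw [h3] at hg
              rw [← hg] at this
              linarith
            have h5 : slope m κ x = 0 := by
              have := slope_flow hm τ x κ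
              rw [← hs, h3] at this
              linarith
            have := decel_eq_zero hm h4 h5
            linarith
          · filter_upwards [Ioo_mem_nhdsGT (show τ < τ + 2 * slope m κ (flow m τ x) by linarith)]
              with t ht
            rw [hexp κ τ t, ← hg, ha]
            have h1 : 0 < t - τ := sub_pos.2 ht.1
            nlinarith [ht.2]
      · exact (((hcont κ).tendsto τ).eventually (eventually_ge_nhds hg)).filter_mono
          nhdsWithin_le_nhds
    obtain ⟨t, ht, ht'⟩ := ((eventually_all.2 hev).and self_mem_nhdsWithin).exists
    have ht' : τ < t := ht'
    exact absurd (le_csSup hbdd (show t ∈ A from ⟨hτA.1.trans ht'.le, (hmem t).2 ht⟩))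
      (not_le.2 ht')
  have hpre : flow m τ x ∈ preCollision m c κ := mem_preCollision_iff.2 ⟨hτA.2, hκ⟩
  refine ⟨τ, κ, ⟨⟨hτA.1, Set.mem_iUnion.2 ⟨κ, hpre⟩⟩, fun t ht => ?_⟩, hpre⟩
  -- A gap that closes with negative slope before `τ` would be negative at `τ`, since the
  -- deceleration is never negative.
  obtain ⟨κ', hκ'⟩ := Set.mem_iUnion.1 ht.2
  obtain ⟨-, h1, h2⟩ := mem_preCollision_iff.1 hκ'
  by_contra! h3
  have h4 := (hmem τ).1 hτA.2 κ'
  rw [hexp κ' t τ, h1] at h4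
  have h5 := mul_neg_of_pos_of_neg (sub_pos.2 h3) h2
  rcases decel_eq κ' x with ha | ha <;> rw [ha] at h4 <;> nlinarith [sq_nonneg (τ - t)]

theorem energy_collide {m : Fin (n + 1) → ℝ} (hm : ∀ i, 0 < m i) (κ : Collision n)
    (x : Phase n) : energy m (collide m κ x) = energy m x := by
  cases κ with
  | floor =>
    refine Finset.sum_congr rfl fun j _ => ?_
    by_cases h : j = 0
    · subst h; simp [collide]
    · simp [collide, h]
  | pair i =>
    have hne : i.castSucc ≠ i.succ := i.castSucc_lt_succ.ne
    rw [← sub_eq_zero, energy, energy, ← Finset.sum_sub_distrib,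
      Finset.sum_eq_add i.castSucc i.succ hne (fun j _ hj => by simp [collide, hj.1, hj.2])
        (by simp) (by simp)]
    have a := hm i.castSucc
    have b := hm i.succ
    simp only [collide, if_true, hne.symm, if_false, gamma]
    field_simp
    ring

theorem collide_mem {m : Fin (n + 1) → ℝ} (hm : ∀ i, 0 < m i) {c : ℝ} {x : Phase n}
    (hx : x ∈ energySurface m c) (κ : Collision n) : collide m κ x ∈ energySurface m c := by
  have hq : (collide m κ x).q = x.q := by cases κ <;> rfl
  exact ⟨hq ▸ hx.1, hq ▸ hx.2.1, (energy_collide hm κ x).trans hx.2.2⟩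

theorem preCollision_subset (m : Fin (n + 1) → ℝ) (c : ℝ) (κ : Collision n) :
    preCollision m c κ ⊆ energySurface m c := fun _ hx => (mem_preCollision_iff.1 hx).1

theorem poincareSection_subset (m : Fin (n + 1) → ℝ) (c : ℝ) :
    poincareSection m c ⊆ energySurface m c := by
  refine Set.iUnion_subset fun κ => ?_
  cases κ <;> exact fun x hx => hx.1

theorem nonempty_orbit {m : Fin (n + 1) → ℝ} (hm : ∀ i, 0 < m i) {c : ℝ} (hc : 0 < c)
    {x : Phase n} (hx : x ∈ energySurface m c) : Nonempty (Orbit m c x) := by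
  choose τ κ hτ hκ using fun y : energySurface m c => exists_isReturnTime hm hc y.2
  let next : energySurface m c → energySurface m c := fun y =>
    ⟨collide m (κ y) (flow m (τ y) y), collide_mem hm (preCollision_subset m c _ (hκ y)) _⟩
  let s : ℕ → energySurface m c := fun k => next^[k] ⟨x, hx⟩
  have hs : ∀ k, s (k + 1) = next (s k) := fun k => Function.iterate_succ_apply' next k _
  let t : ℕ → ℝ := fun k => ∑ i ∈ Finset.range k, τ (s i)
  have ht : ∀ k, t (k + 1) - t k = τ (s k) := fun k => by
    simp only [t, Finset.sum_range_succ, add_sub_cancel_left]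
  exact ⟨{
    state := fun k => s k
    time := t
    coll := fun k => κ (s k)
    state_zero := rfl
    time_zero := Finset.sum_range_zero _
    isReturnTime := fun k => by rw [ht]; exact hτ (s k)
    mem_preCollision := fun k => by rw [ht]; exact hκ (s k)
    state_succ := fun k => by rw [ht, hs] }⟩

end FallingBalls

namespace FallingBalls

open Finset

variable {n : ℕ}

/-! ### From orbits to sequences -/

/-- The ball with number `j`, and the top ball if there is no such ball. -/
def ball (n j : ℕ) : Fin (n + 1) := ⟨min j n, by omega⟩

theorem ball_coe (j : Fin (n + 1)) : ball n j = j := Fin.ext (min_eq_left (Nat.lt_succ_iff.1 j.2))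

theorem ball_castSucc (i : Fin n) : ball n i = i.castSucc := Fin.ext (min_eq_left i.2.le)

theorem ball_succ (i : Fin n) : ball n (i + 1) = i.succ := Fin.ext (min_eq_left i.2)

theorem ball_zero : ball n 0 = 0 := Fin.ext (min_eq_left (Nat.zero_le n))

theorem ball_val {j : ℕ} (hj : j ≤ n) : (ball n j : ℕ) = j := min_eq_left hj

theorem ball_mono {i j : ℕ} (h : i ≤ j) : ball n i ≤ ball n j := by
  simp only [ball, Fin.mk_le_mk]; omega

theorem resting_ball_iff {m : Fin (n + 1) → ℝ} (hm : ∀ i, 0 < m i) {x : Phase n} {j : ℕ}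
    (hj : j ≤ n) : Resting x (ball n j) ↔
      ∀ i ≤ j, x.q (ball n i) = 0 ∧ vel m x (ball n i) = 0 := by
  have h : ∀ k, x.p k = 0 ↔ vel m x k = 0 := fun k => by simp [vel, (hm k).ne']
  constructor
  · intro hR i hi
    rw [← h]
    exact hR _ (ball_mono hi)
  · intro hR k hk
    have h1 := hR k (by have := Fin.le_def.1 hk; rwa [ball_val hj] at this)
    rwa [ball_coe, ← h] at h1

/-- The number of a collision. -/
def Collision.toNat : Collision n → ℕ
  | .floor => 0
  | .pair i => i + 1

/-- The momentum transferred by the collision `κ` from the state `x`. -/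
noncomputable def transfer (m : Fin (n + 1) → ℝ) (x : Phase n) : Collision n → ℝ
  | .floor => -(2 * m 0 * vel m x 0)
  | .pair i => 2 * m i.castSucc * m i.succ * (vel m x i.castSucc - vel m x i.succ) /
      (m i.castSucc + m i.succ)

theorem Collision.toNat_le (κ : Collision n) : κ.toNat ≤ n := by
  cases κ with
  | floor => exact Nat.zero_le n
  | pair i => exact i.2

theorem transfer_pos {m : Fin (n + 1) → ℝ} (hm : ∀ i, 0 < m i) {c : ℝ} {κ : Collision n}
    {x : Phase n} (hx : x ∈ preCollision m c κ) : 0 < transfer m x κ := by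
  cases κ with
  | floor =>
    have h1 : vel m x 0 < 0 := hx.2.2
    have h2 := hm 0
    simp only [transfer]
    nlinarith
  | pair i =>
    have h1 := sub_pos.2 hx.2.2
    have h2 := hm i.castSucc
    have h3 := hm i.succ
    simp only [transfer]
    positivity

theorem vel_collide {m : Fin (n + 1) → ℝ} (hm : ∀ i, 0 < m i) (κ : Collision n) (x : Phase n)
    {j : ℕ} (hj : j ≤ n) : m (ball n j) * vel m (collide m κ x) (ball n j) =
      m (ball n j) * vel m x (ball n j) + (if κ.toNat = j then transfer m x κ else 0) -
        (if κ.toNat = j + 1 then transfer m x κ else 0) := by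
  have hp : ∀ y : Phase n, m (ball n j) * vel m y (ball n j) = y.p (ball n j) := fun y => by
    rw [vel, mul_div_cancel₀ _ (hm _).ne']
  rw [hp, hp]
  cases κ with
  | floor =>
    rw [show (Collision.floor : Collision n).toNat = 0 from rfl]
    simp only [transfer, collide]
    rcases Nat.eq_zero_or_pos j with rfl | h
    · have := (hm 0).ne'
      rw [ball_zero, Function.update_self, if_pos rfl, if_neg (by omega), vel]
      field_simp
      ring
    · rw [Function.update_of_ne, if_neg (by omega), if_neg (by omega)]
      · ring
      · intro h'
        have := congrArg Fin.val h'
        rw [ball_val hj, Fin.val_zero] at this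
        omega
  | pair i =>
    have a := hm i.castSucc
    have b := hm i.succ
    have hne : i.castSucc ≠ i.succ := i.castSucc_lt_succ.ne
    rw [show (Collision.pair i).toNat = i + 1 from rfl]
    simp only [transfer, collide]
    by_cases h1 : j = i
    · subst h1
      rw [ball_castSucc, if_pos rfl, if_neg (by omega), if_pos rfl, gamma, vel, vel]
      field_simp
      ring
    by_cases h2 : j = i + 1
    · subst h2
      rw [ball_succ, if_neg hne.symm, if_pos rfl, if_pos rfl, if_neg (by omega), gamma, vel, vel]
      field_simp
      ring
    · rw [if_neg, if_neg, if_neg (by omega), if_neg (by omega)]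
      · ring
      · intro h
        have := congrArg Fin.val h
        rw [ball_val hj, Fin.val_succ] at this
        exact h2 this
      · intro h
        have := congrArg Fin.val h
        rw [ball_val hj, Fin.val_castSucc] at this
        exact h1 this

theorem q_collide (m : Fin (n + 1) → ℝ) (κ : Collision n) (x : Phase n) :
    (collide m κ x).q = x.q := by cases κ <;> rfl

/-- A state in which a ball on the floor moves downward is right before a collision. -/
theorem mem_preSection_of_vel_neg {m : Fin (n + 1) → ℝ} {c : ℝ} {x : Phase n}
    (hx : x ∈ energySurface m c) :
    ∀ j ≤ n, x.q (ball n j) = 0 → vel m x (ball n j) < 0 → x ∈ preSection m c := by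
  intro j
  induction j with
  | zero =>
    intro _ hq hv
    rw [ball_zero] at hq hv
    exact Set.mem_iUnion.2 ⟨.floor, hx, hq, hv⟩
  | succ i ih =>
    intro hi hq hv
    have hle : x.q (ball n i) ≤ 0 := hq ▸ hx.2.1 (ball_mono (Nat.le_succ i))
    have hq' : x.q (ball n i) = 0 := le_antisymm hle (hx.1.trans (hx.2.1 (Fin.zero_le _)))
    -- Either the ball below moves down at least as fast and the argument descends, or these two
    -- balls are about to collide.
    by_cases h : vel m x (ball n i) ≤ vel m x (ball n (i + 1))
    · exact ih (by omega) hq' (h.trans_lt hv)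
    · push Not at h
      rw [← hq] at hq'
      have e1 := ball_castSucc (⟨i, hi⟩ : Fin n)
      have e2 := ball_succ (⟨i, hi⟩ : Fin n)
      rw [e1, e2] at h hq'
      exact Set.mem_iUnion.2 ⟨.pair ⟨i, hi⟩, hx, hq', h⟩

theorem flow_zero {m : Fin (n + 1) → ℝ} (x : Phase n) : flow m 0 x = x := by
  ext j
  · by_cases h : Resting x j
    · simp [flow, h, (h j le_rfl).1]
    · simp [flow, h]
  · by_cases h : Resting x j
    · simp [flow, h, (h j le_rfl).2]
    · simp [flow, h]

namespace Orbit

variable {m : Fin (n + 1) → ℝ} {c : ℝ} {x : Phase n}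

theorem pre_mem (o : Orbit m c x) (k : ℕ) : o.pre k ∈ preCollision m c (o.coll k) :=
  o.mem_preCollision k

theorem succ_eq (o : Orbit m c x) (k : ℕ) : o.state (k + 1) = collide m (o.coll k) (o.pre k) :=
  o.state_succ k

theorem state_mem (hm : ∀ i, 0 < m i) (hx : x ∈ energySurface m c) (o : Orbit m c x) (k : ℕ) :
    o.state k ∈ energySurface m c := by
  cases k with
  | zero => rw [o.state_zero]; exact hx
  | succ k =>
    rw [o.succ_eq]
    exact collide_mem hm (preCollision_subset m c _ (o.pre_mem k)) _

/-- The sequence of heights, velocities and collisions of an orbit. -/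
noncomputable def toBallSeq (hm : ∀ i, 0 < m i) (hx : x ∈ energySurface m c) (o : Orbit m c x) :
    BallSeq n (fun j => m (ball n j)) c where
  t := o.time
  q k j := (o.state k).q (ball n j)
  v k j := vel m (o.state k) (ball n j)
  u k j := vel m (o.pre k) (ball n j)
  W k := (o.coll k).toNat
  J k := transfer m (o.pre k) (o.coll k)
  W_le k := (o.coll k).toNat_le
  J_pos k := transfer_pos hm (o.pre_mem k)
  t_le k := sub_nonneg.1 (o.isReturnTime k).1.1
  q_nonneg k j _ := (o.state_mem hm hx k).1.trans ((o.state_mem hm hx k).2.1 (Fin.zero_le _))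
  energy_eq k := by
    refine Eq.trans ?_ (o.state_mem hm hx k).2.2
    rw [energy, ← Nat.range_succ_eq_Icc_zero, sum_range]
    refine sum_congr rfl fun j _ => ?_
    have := (hm j).ne'
    rw [ball_coe, vel]
    field_simp
  fall k j hj := by
    rcases vel_flow hm (o.time (k + 1) - o.time k) (o.state k) (ball n j) with ⟨h, h'⟩ | ⟨_, h'⟩
    · exact Or.inr ⟨(resting_ball_iff hm hj).1 h, h'⟩
    · exact Or.inl h'
  move k j _ := by
    rw [o.succ_eq, q_collide]
    rcases q_flow m (o.time (k + 1) - o.time k) (o.state k) (ball n j) with ⟨h, h'⟩ | ⟨h, h'⟩ <;>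
      rcases vel_flow hm (o.time (k + 1) - o.time k) (o.state k) (ball n j)
        with ⟨g, g'⟩ | ⟨g, g'⟩
    · rw [pre, h', g', h.vel_eq, (h _ le_rfl).1]; ring
    · exact absurd h g
    · exact absurd g h
    · rw [pre, h', g']; ring
  hit k j hj := by
    rw [o.succ_eq]
    exact vel_collide hm _ _ hj
  floor k hW := by
    have h := o.pre_mem k
    rw [o.succ_eq, q_collide, ball_zero]
    cases hκ : o.coll k with
    | floor =>
      rw [hκ] at h
      exact ⟨rfl, h.2.1⟩
    | pair i => rw [hκ] at hW; exact absurd hW (Nat.succ_ne_zero _)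
  pair k i hW := by
    have h := o.pre_mem k
    rw [o.succ_eq, q_collide]
    cases hκ : o.coll k with
    | floor => rw [hκ] at hW; exact absurd hW (Nat.succ_ne_zero _).symm
    | pair i' =>
      rw [hκ] at hW h
      obtain rfl : (i' : ℕ) = i := Nat.succ_injective hW
      rw [ball_castSucc, ball_succ]
      exact ⟨div_mul_cancel₀ _ (add_pos (hm _) (hm _)).ne', h.2.1⟩
  frozen k j hj hq hv := by
    have h1 := mem_preSection_of_vel_neg (o.state_mem hm hx k) j hj hq hv
    have h2 := (o.isReturnTime k).2 ⟨le_rfl, (flow_zero (m := m) (o.state k)).symm ▸ h1⟩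
    have h3 := (o.isReturnTime k).1.1
    linarith

end Orbit

/-! ### From strong impulses to the theorem -/

theorem exists_strong_pair {m : Fin (n + 1) → ℝ} (hm : ∀ i, 0 < m i) {c : ℝ} (hc : 0 < c)
    (i : Fin n) : ∃ C > 0, ∀ x ∈ energySurface m c, ∀ (o : Orbit m c x) (a : ℕ), ∃ k ≥ a,
      o.coll k = .pair i ∧ C ≤ vel m (o.pre k) i.castSucc - vel m (o.pre k) i.succ := by
  have a := hm i.castSucc
  have b := hm i.succ
  obtain ⟨C, hC, h⟩ := BallSeq.exists_strong (m := fun j => m (ball n j)) (n := n)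
    (fun _ => hm _) hc (w := i + 1) i.2
  -- The impulse is twice the reduced mass times the relative velocity.
  refine ⟨C * (m i.castSucc + m i.succ) / (2 * m i.castSucc * m i.succ), by positivity,
    fun x hx o a' => ?_⟩
  obtain ⟨k, hk, hW, hJ⟩ := h (o.toBallSeq hm hx) a'
  change (o.coll k).toNat = i + 1 at hW
  change C ≤ transfer m (o.pre k) (o.coll k) at hJ
  cases hκ : o.coll k with
  | floor => rw [hκ] at hW; exact absurd hW (Nat.succ_ne_zero _).symm
  | pair i' =>
    rw [hκ] at hW hJ
    obtain rfl : i' = i := Fin.ext (Nat.succ_injective hW)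
    refine ⟨k, hk, hκ, ?_⟩
    rw [transfer, le_div_iff₀ (by positivity)] at hJ
    rw [div_le_iff₀ (by positivity)]
    linarith

end FallingBalls

theorem mainTheorem3 (n : ℕ) (m : Fin (n + 1) → ℝ) (hm_pos : ∀ i, 0 < m i) (hm : StrictAnti m)
    (c : ℝ) (hc : 0 < c) :
    ∃ C : ℝ, 0 < C ∧ ∀ x ∈ FallingBalls.poincareSection m c,
      Nonempty (FallingBalls.Orbit m c x) ∧
      ∀ (o : FallingBalls.Orbit m c x) (i : Fin n),
        ∃ k : ℕ → ℕ, StrictMono k ∧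
          Filter.Tendsto (fun j => o.time (k j + 1)) Filter.atTop Filter.atTop ∧
          ∀ j, o.coll (k j) = FallingBalls.Collision.pair i ∧
            C ≤ FallingBalls.vel m (o.pre (k j)) i.castSucc
              - FallingBalls.vel m (o.pre (k j)) i.succ := by
  choose C hC h using FallingBalls.exists_strong_pair hm_pos hc
  -- Taking a small positive number instead of a minimum also covers `n = 0`, where there are no
  -- pairs.
  obtain ⟨C₀, hC₀, hle⟩ : ∃ C₀ > 0, ∀ i, C₀ ≤ C i := by
    have h1 : ∀ᶠ C₀ in nhdsWithin (0 : ℝ) (Set.Ioi 0), ∀ i, C₀ ≤ C i :=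
      Filter.eventually_all.2 fun i => (eventually_le_nhds (hC i)).filter_mono nhdsWithin_le_nhds
    obtain ⟨C₀, h2, h3⟩ := (h1.and self_mem_nhdsWithin).exists
    exact ⟨C₀, h3, h2⟩
  refine ⟨C₀, hC₀, fun x hx => ?_⟩
  have hx' := FallingBalls.poincareSection_subset m c hx
  refine ⟨FallingBalls.nonempty_orbit hm_pos hc hx', fun o i => ?_⟩
  obtain ⟨k, hk, hk'⟩ := Filter.extraction_of_frequently_atTop
    (Filter.frequently_atTop.2 (h i x hx' o))
  refine ⟨k, hk, ?_, fun j => ⟨(hk' j).1, (hle i).trans (hk' j).2⟩⟩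
  exact ((o.toBallSeq hm_pos hx').tendsto_t (fun _ => hm_pos _) hc.le).comp
    ((Filter.tendsto_add_atTop_nat 1).comp hk.tendsto_atTop)
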